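/- \textbf{Setting.} Terms are pure $\lambda$-terms $M,N ::= x \mid \lambda x.M \mid M\,N$ up to $\alpha$-equivalence, with $\beta$-reduction $\to_\beta$, the congruent closure of $(\lambda x.M)\,N\to M\{x:=N\}$. \emph{Types.} Given countably infinitely many atomic types $\tau$, put $F ::= \tau \mid A\to F$, $\;A,B ::= F\mid A\cap B$, $\;U,V ::= A\mid\omega$. The operation $\cap$ is extended to $U$-types with $\omega$ as neutral element. Let $\approx$ be the equivalence generated by associativity and commutativity of $\cap$ (with congruence for $\cap$, but not under arrows), and let $U\subseteq V$ mean that $U\approx V\cap U'$ for some $U'$. A context $\Gamma$ maps variables to $U$-types, with value $\omega$ at all but finitely many variables; $\Gamma\cap\Delta$ is pointwise, and unmentioned variables have type $\omega$. \emph{Typing trees} are built with the rules \[ \frac{}{x:F\vdash x:F}\qquad \frac{\Gamma,x:U\vdash M:F\quad A\subseteq U}{\Gamma\vdash\lambda x.M:A\to F}\qquad \frac{\Gamma\vdash M:A\to F\quad \Delta\vdash N:A}{\Gamma\cap\Delta\vdash M\,N:F} \] \[ \frac{\Gamma\vdash M:A\quad\Delta\vdash M:B}{\Gamma\cap\Delta\vdash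 M:A\cap B}\qquad \frac{}{\vdash M:\omega}. \] The first three rules are called (Var), (Abs) and (App). A tree uses \emph{no subsumption} if in each instance of (Abs) either $A\approx U$ or $U=\omega$; in an instance with $U=\omega$ the type $A$ is called \emph{forgotten}. \emph{Refined types and degrees.} Let $A^+ ::= \tau\mid A^{--}\to B^+$, $\;A^- ::= \tau\mid A^+\to B^-$, $\;A^{--} ::= A^-\mid A^{--}\cap B^{--}$. The degree counts the arrows in negative positions: $\delta^+(\tau)=\delta^-(\tau)=0$, $\;\delta^+(A^{--}\to B^+)=\delta^-(A^{--})+\delta^+(B^+)$, $\;\delta^-(A^+\to B^-)=\delta^+(A^+)+\delta^-(B^-)+1$, $\;\delta^-(A^{--}\cap B^{--})=\delta^-(A^{--})+\delta^-(B^{--})$. A typing tree $\pi$ of $\Gamma\vdash M:A$ is \emph{optimal} if it uses no subsumption, $A$ and all forgotten types of $\pi$ are of the form $A^+$, and each $\Gamma(x)$ is $\omega$ or of the form $A^{--}$. Its \emph{degree} is $\delta^+(A)+\sum_{x:\,\Gamma(x)\neq\omega}\delta^-(\Gamma(x))+\sum_{C}\delta^+(C)$, where $C$ runs over the forgotten types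 of $\pi$, counted with multiplicity. It is \emph{principal} if it is optimal and its degree is at most that of every optimal typing tree of $M$ (with any context and type). \emph{Perpetual strategy.} $\Rightarrow_{head}$ is the least relation such that, for all sequences $\vec P,\vec Q$ of terms, \begin{itemize} \item $(\lambda x.M)\,N\,\vec P\Rightarrow_{head}M\{x:=N\}\,\vec P$ if $x\in fv(M)$ or $N$ is $\beta$-normal; \item $(\lambda x.M)\,N\,\vec P\Rightarrow_{head}(\lambda x.M)\,N'\,\vec P$ if $x\notin fv(M)$ and $N\Rightarrow_{head}N'$; \item $x\,\vec P\,M\,\vec Q\Rightarrow_{head}x\,\vec P\,M'\,\vec Q$ and $\lambda x.M\Rightarrow_{head}\lambda x.M'$ if $M\Rightarrow_{head}M'$. \end{itemize} \textbf{Theorem (Complexity result).} Let $M$ be a pure $\lambda$-term with a principal typing tree that has $n$ uses of (App) and degree $d$. Then $d\le n$, and the longest $\beta$-reduction sequence from $M$ has length exactly $n-d$: there is a $\beta$-reduction sequence of length $n-d$ from $M$, and none is longer. This length is realised by the perpetual strategy: there is a $\Rightarrow_{head}$-sequence of length $n-d$ from $M$ to a $\beta$-normal form, and every $\Rightarrow_{head}$-sequence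 from $M$ to a $\beta$-normal form has length $n-d$. -/

import Mathlib

namespace PureLambda

/-! ## Pure lambda-terms up to alpha-equivalence, in de Bruijn notation -/

/-- Pure lambda-terms. The variables are de Bruijn indices: under `k` abstractions, an index
`i < k` is bound and an index `k + j` denotes the free variable `j`. -/
inductive Term : Type
  | var (x : ℕ) : Term
  | lam (M : Term) : Term
  | app (M N : Term) : Term

namespace Term

/-- The renaming `ρ`, pushed under one abstraction. -/
def upRen (ρ : ℕ → ℕ) : ℕ → ℕ
  | 0 => 0
  | n + 1 => ρ n + 1

/-- Renaming of the free variables along `ρ`. -/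
def rename : (ℕ → ℕ) → Term → Term
  | ρ, var x => var (ρ x)
  | ρ, lam M => lam (rename (upRen ρ) M)
  | ρ, app M N => app (rename ρ M) (rename ρ N)

/-- The substitution `σ`, pushed under one abstraction. -/
def up (σ : ℕ → Term) : ℕ → Term
  | 0 => var 0
  | n + 1 => rename Nat.succ (σ n)

/-- Capture-avoiding parallel substitution. -/
def subst : (ℕ → Term) → Term → Term
  | σ, var x => σ x
  | σ, lam M => lam (subst (up σ) M)
  | σ, app M N => app (subst σ M) (subst σ N)

/-- The substitution that sends variable `0` to `N` and lowers all the other variables. -/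
def single (N : Term) : ℕ → Term
  | 0 => N
  | n + 1 => var n

/-- `inst M N` is `M{x := N}`, where `M` is the body of `λx.M` (so that `x` is index `0`). -/
def inst (M N : Term) : Term := subst (single N) M

/-- `FreeIn k M`: the variable `k` occurs free in `M`. -/
def FreeIn : ℕ → Term → Prop
  | k, var x => x = k
  | k, lam M => FreeIn (k + 1) M
  | k, app M N => FreeIn k M ∨ FreeIn k N

/-- `apps M [M₁, …, Mₖ]` is `M M₁ … Mₖ`. -/
def apps (M : Term) (l : List Term) : Term := l.foldl app M

end Term

open Term in
/-- One step of beta-reduction: the congruent closure of `(λx.M) N → M{x := N}`. -/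
inductive Beta : Term → Term → Prop
  | beta (M N : Term) : Beta (app (lam M) N) (inst M N)
  | lam {M M' : Term} : Beta M M' → Beta (lam M) (lam M')
  | appL {M M' : Term} (N : Term) : Beta M M' → Beta (app M N) (app M' N)
  | appR (M : Term) {N N' : Term} : Beta N N' → Beta (app M N) (app M N')

/-- `M` is a beta-normal form. -/
def BetaNormal (M : Term) : Prop := ∀ N, ¬ Beta M N

open Term in
/-- One step of the perpetual strategy. -/
inductive Head : Term → Term → Prop
  | beta (M N : Term) (l : List Term) (h : FreeIn 0 M ∨ BetaNormal N) :
      Head (apps (app (lam M) N) l) (apps (inst M N) l)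
  | erased (M : Term) {N N' : Term} (l : List Term) (hN : Head N N') (hM : ¬ FreeIn 0 M) :
      Head (apps (app (lam M) N) l) (apps (app (lam M) N') l)
  | arg (x : ℕ) (l₁ : List Term) {M M' : Term} (l₂ : List Term) (hM : Head M M') :
      Head (apps (var x) (l₁ ++ M :: l₂)) (apps (var x) (l₁ ++ M' :: l₂))
  | lam {M M' : Term} (hM : Head M M') : Head (lam M) (lam M')

/-- `Steps r k M N`: there is a sequence of exactly `k` steps of `r` from `M` to `N`. -/
inductive Steps (r : Term → Term → Prop) : ℕ → Term → Term → Prop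
  | refl (M : Term) : Steps r 0 M M
  | step {k : ℕ} {M N P : Term} : r M N → Steps r k N P → Steps r (k + 1) M P

/-! ## Intersection types -/

mutual
/-- `F`-types: an atomic type (atomic types are indexed by `ℕ`) or an arrow `A → F`. -/
inductive FTy : Type
  | atom (t : ℕ) : FTy
  | arr (A : ATy) (F : FTy) : FTy
/-- `A`-types: an `F`-type or an intersection `A ∩ B`; no equations are imposed on `∩`. -/
inductive ATy : Type
  | ofF (F : FTy) : ATy
  | inter (A B : ATy) : ATy
end

/-- `U`-types: an `A`-type or the empty type `ω`. -/
inductive UTy : Type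
  | omega : UTy
  | ofA (A : ATy) : UTy

/-- Intersection extended to `U`-types, with `ω` as neutral element. -/
def UTy.inter : UTy → UTy → UTy
  | .omega, V => V
  | U, .omega => U
  | .ofA A, .ofA B => .ofA (.inter A B)

/-- The equivalence `≈` on `A`-types: associativity and commutativity of the top-level
intersections (not under arrows). -/
inductive AEquiv : ATy → ATy → Prop
  | refl (F : FTy) : AEquiv (.ofF F) (.ofF F)
  | comm (A B : ATy) : AEquiv (.inter A B) (.inter B A)
  | congr {A A' B B' : ATy} : AEquiv A A' → AEquiv B B' → AEquiv (.inter A B) (.inter A' B')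
  | trans {A B C : ATy} : AEquiv A B → AEquiv B C → AEquiv A C
  | assoc (A B C : ATy) : AEquiv (.inter (.inter A B) C) (.inter A (.inter B C))
  | assoc' (A B C : ATy) : AEquiv (.inter A (.inter B C)) (.inter (.inter A B) C)

/-- The equivalence `≈` on `U`-types. -/
inductive UEquiv : UTy → UTy → Prop
  | omega : UEquiv .omega .omega
  | ofA {A B : ATy} : AEquiv A B → UEquiv (.ofA A) (.ofA B)

/-- Subtyping: `U ⊆ V` if `U ≈ V ∩ U'` for some `U'`. -/
def USub (U V : UTy) : Prop := ∃ U' : UTy, UEquiv U (V.inter U')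

/-! ## Typing contexts and typing trees -/

/-- Contexts: total maps from variables to `U`-types. The contexts of typing trees have finite
domain, see `Tree.finite_dom`. -/
abbrev Ctx : Type := ℕ → UTy

/-- The context `x : U`. -/
def Ctx.single (x : ℕ) (U : UTy) : Ctx := fun y => if y = x then U else .omega

/-- Pointwise intersection of contexts. -/
def Ctx.inter (Γ Δ : Ctx) : Ctx := fun x => (Γ x).inter (Δ x)

/-- Typing trees with conclusion `Γ ⊢ M : U`. In rule `abs` the context of the premise is
`Γ 1, Γ 2, …` for the free variables of `λx.M`, together with `x : Γ 0`. -/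
inductive Tree : Ctx → Term → UTy → Type
  | var (x : ℕ) (F : FTy) : Tree (Ctx.single x (.ofA (.ofF F))) (.var x) (.ofA (.ofF F))
  | abs {Γ : Ctx} {M : Term} {F : FTy} (A : ATy) (π : Tree Γ M (.ofA (.ofF F)))
      (h : USub (.ofA A) (Γ 0)) :
      Tree (fun x => Γ (x + 1)) (.lam M) (.ofA (.ofF (.arr A F)))
  | app {Γ Δ : Ctx} {M N : Term} {A : ATy} {F : FTy}
      (π₁ : Tree Γ M (.ofA (.ofF (.arr A F)))) (π₂ : Tree Δ N (.ofA A)) :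
      Tree (Γ.inter Δ) (.app M N) (.ofA (.ofF F))
  | inter {Γ Δ : Ctx} {M : Term} {A B : ATy}
      (π₁ : Tree Γ M (.ofA A)) (π₂ : Tree Δ M (.ofA B)) :
      Tree (Γ.inter Δ) M (.ofA (.inter A B))
  | omega (M : Term) : Tree (fun _ => .omega) M .omega

/-! ## Refined types and degrees of types -/

mutual
/-- `F` is of the form `A⁺ ::= τ | A⁻⁻ → B⁺`. -/
def FTy.IsPos : FTy → Prop
  | .atom _ => True
  | .arr A F => A.IsNegNeg ∧ F.IsPos
/-- `F` is of the form `A⁻ ::= τ | A⁺ → B⁻`. -/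
def FTy.IsNeg : FTy → Prop
  | .atom _ => True
  | .arr A F => A.IsPos ∧ F.IsNeg
/-- An `A`-type of the form `A⁺` (in particular not an intersection). -/
def ATy.IsPos : ATy → Prop
  | .ofF F => F.IsPos
  | .inter _ _ => False
/-- `A` is of the form `A⁻⁻ ::= A⁻ | A⁻⁻ ∩ B⁻⁻`. -/
def ATy.IsNegNeg : ATy → Prop
  | .ofF F => F.IsNeg
  | .inter A B => A.IsNegNeg ∧ B.IsNegNeg
end

/-- A `U`-type of the form `A⁺`. -/
def UTy.IsPos : UTy → Prop
  | .omega => False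
  | .ofA A => A.IsPos

/-- `U` is of the form `U⁻⁻ ::= A⁻⁻ | ω`. -/
def UTy.IsNegNeg : UTy → Prop
  | .omega => True
  | .ofA A => A.IsNegNeg

mutual
/-- The number of arrows in negative positions of a type `A⁺`. -/
def FTy.degPos : FTy → ℕ
  | .atom _ => 0
  | .arr A F => A.degNeg + F.degPos
/-- The number of arrows of a type `A⁻` that are in negative positions when the whole type is
itself in a negative position. -/
def FTy.degNeg : FTy → ℕ
  | .atom _ => 0
  | .arr A F => A.degPos + F.degNeg + 1
/-- The degree of a type `A⁺`; the clause for intersections is never used on such a type. -/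
def ATy.degPos : ATy → ℕ
  | .ofF F => F.degPos
  | .inter A B => A.degPos + B.degPos
/-- The degree of a type `A⁻⁻`. -/
def ATy.degNeg : ATy → ℕ
  | .ofF F => F.degNeg
  | .inter A B => A.degNeg + B.degNeg
end

/-- The degree of a `U`-type in output position. -/
def UTy.degPos : UTy → ℕ
  | .omega => 0
  | .ofA A => A.degPos

/-- The degree of a `U`-type in a context. -/
def UTy.degNeg : UTy → ℕ
  | .omega => 0
  | .ofA A => A.degNeg

/-! ## Measures and properties of typing trees -/

namespace Tree

/-- The number of uses of the application rule. -/
def appCount : {Γ : Ctx} → {M : Term} → {U : UTy} → Tree Γ M U → ℕ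
  | _, _, _, .var _ _ => 0
  | _, _, _, .abs _ π _ => π.appCount
  | _, _, _, .app π₁ π₂ => π₁.appCount + π₂.appCount + 1
  | _, _, _, .inter π₁ π₂ => π₁.appCount + π₂.appCount
  | _, _, _, .omega _ => 0

/-- No subsumption: in every abstraction rule the side condition `A ⊆ U` holds
because `A ≈ U` or because `U = ω`. -/
def NoSubsumption : {Γ : Ctx} → {M : Term} → {U : UTy} → Tree Γ M U → Prop
  | _, _, _, .var _ _ => True
  | _, _, _, .abs (Γ := Γ) A π _ =>
      (UEquiv (.ofA A) (Γ 0) ∨ Γ 0 = .omega) ∧ π.NoSubsumption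
  | _, _, _, .app π₁ π₂ => π₁.NoSubsumption ∧ π₂.NoSubsumption
  | _, _, _, .inter π₁ π₂ => π₁.NoSubsumption ∧ π₂.NoSubsumption
  | _, _, _, .omega _ => True

/-- The list of forgotten types: the types `A` of the abstraction rules whose side condition
is `A ⊆ ω`, collected by a prefix depth-first search. -/
def forg : {Γ : Ctx} → {M : Term} → {U : UTy} → Tree Γ M U → List ATy
  | _, _, _, .var _ _ => []
  | _, _, _, .abs (Γ := Γ) A π _ =>
      match Γ 0 with
      | .omega => A :: π.forg
      | .ofA _ => π.forg
  | _, _, _, .app π₁ π₂ => π₁.forg ++ π₂.forg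
  | _, _, _, .inter π₁ π₂ => π₁.forg ++ π₂.forg
  | _, _, _, .omega _ => []

/-- Optimal typing trees. -/
def Optimal {Γ : Ctx} {M : Term} {U : UTy} (π : Tree Γ M U) : Prop :=
  π.NoSubsumption ∧ U.IsPos ∧ (∀ x, (Γ x).IsNegNeg) ∧ ∀ B ∈ π.forg, B.IsPos

/-- The degree of a typing tree: of its output type, of its context (a sum with finitely many
nonzero terms, by `finite_dom`) and of its forgotten types. -/
noncomputable def degree {Γ : Ctx} {M : Term} {U : UTy} (π : Tree Γ M U) : ℕ :=
  U.degPos + (∑ᶠ x, (Γ x).degNeg) + (π.forg.map ATy.degPos).sum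

/-- Principal typing trees of `M`: optimal, and of minimal degree among all the optimal typing
trees of `M`, whatever their contexts and types. -/
def Principal {Γ : Ctx} {M : Term} {U : UTy} (π : Tree Γ M U) : Prop :=
  π.Optimal ∧ ∀ (Γ' : Ctx) (U' : UTy) (π' : Tree Γ' M U'), π'.Optimal → π.degree ≤ π'.degree

/-- The context of a typing tree has finite domain. -/
theorem finite_dom {Γ : Ctx} {M : Term} {U : UTy} (π : Tree Γ M U) :
    {x | Γ x ≠ .omega}.Finite := by
  have key : ∀ Γ Δ : Ctx, {x | Γ x ≠ .omega}.Finite → {x | Δ x ≠ .omega}.Finite →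
      {x | Γ.inter Δ x ≠ .omega}.Finite := by
    intro Γ Δ h₁ h₂
    refine (h₁.union h₂).subset ?_
    intro x hx
    by_contra hc
    have h₃ : Γ x = .omega := by
      by_contra h
      exact hc (Or.inl h)
    have h₄ : Δ x = .omega := by
      by_contra h
      exact hc (Or.inr h)
    exact hx (by simp [Ctx.inter, h₃, h₄, UTy.inter])
  induction π with
  | var x F =>
    refine (Set.finite_singleton x).subset ?_
    intro y hy
    by_contra hc
    have hyx : y ≠ x := hc
    exact hy (by simp [Ctx.single, hyx])
  | abs A π h ih => exact ih.preimage (fun a _ b _ hab => Nat.succ_injective hab)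
  | app π₁ π₂ ih₁ ih₂ => exact key _ _ ih₁ ih₂
  | inter π₁ π₂ ih₁ ih₂ => exact key _ _ ih₁ ih₂
  | omega M => simp

end Tree

end PureLambda

/-!
The proof has two halves that meet in one number, `k`, attached to a term by the predicate
`Perp`: the number of steps of the perpetual strategy, computed by recursion on the head form of
the term. A redex that keeps its argument costs one step plus the cost of its contractum; a redex
that erases its argument costs one step, plus the cost of the contractum, plus the cost of the
argument; a variable applied to arguments costs the sum of the costs of the arguments.

The reduction half is untyped. If `Perp false k M`, then the perpetual strategy reaches a normal
form in `k` steps (`Perp.exists_steps_head`), every perpetual sequence to a normal form yields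
`Perp` for its own length (`Perp.of_steps_head`), and no `β`-reduction sequence is longer than `k`
(`Perp.steps_le`), since the steps inside a head redex can be replayed, without losing any, in its
contractum or in its erased argument.

The typing half shows that the principal trees have `n = k + d` (`Tree.Principal.exists_perp`).
Typing trees are considered modulo associativity and commutativity of `∩`, so that contexts and
intersections are multisets; a derivation `Ty M r F` is then defined by recursion on `M`, and
keeps of the tree only its resources `r`: the context, the number of applications, and the degree
of the forgotten types. These resources are additive, and both substitution and
anti-substitution are the single equivalence `ty_subst`. Hence derivations correspond exactly
along a perpetual contraction: one that keeps its argument removes one application and leaves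
context, type and forgotten types unchanged (`ty_keep_iff`), and one that erases its argument
removes one application together with an optimal derivation for the argument (`ty_erase_iff`).
Since the number of applications decreases, a typable term satisfies `Perp` for some `k`
(`Ty.exists_perp`). By induction on `Perp`, all the optimal derivations of `M` have the same number
`n` of applications, `n ≤ k + d` for each of them, and equality holds for at least one
(`Perp.opt`); so equality holds exactly when `d` is minimal. In a neutral term the induction runs
over all types `A⁻`, and the arrow type of the head contributes to the context one negative arrow
for each application.
-/

namespace PureLambda

/-! ### Renaming and substitution -/

namespace Term

theorem upRen_comp (ρ ξ : ℕ → ℕ) : upRen ρ ∘ upRen ξ = upRen (ρ ∘ ξ) := by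
  funext x; cases x <;> rfl

theorem rename_rename (M : Term) (ρ ξ : ℕ → ℕ) :
    rename ρ (rename ξ M) = rename (ρ ∘ ξ) M := by
  induction M generalizing ρ ξ with
  | var x => rfl
  | lam M ih => simp [rename, ih, upRen_comp]
  | app M N ihM ihN => simp [rename, ihM, ihN]

theorem up_comp_upRen (σ : ℕ → Term) (ρ : ℕ → ℕ) : up σ ∘ upRen ρ = up (σ ∘ ρ) := by
  funext x; cases x <;> rfl

theorem subst_rename (M : Term) (σ : ℕ → Term) (ρ : ℕ → ℕ) :
    subst σ (rename ρ M) = subst (σ ∘ ρ) M := by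
  induction M generalizing σ ρ with
  | var x => rfl
  | lam M ih => simp [rename, subst, ih, up_comp_upRen]
  | app M N ihM ihN => simp [rename, subst, ihM, ihN]

theorem rename_up (σ : ℕ → Term) (ρ : ℕ → ℕ) :
    (fun x => rename (upRen ρ) (up σ x)) = up (fun x => rename ρ (σ x)) := by
  funext x
  cases x with
  | zero => rfl
  | succ x =>
    simp only [up, rename_rename]
    rfl

theorem rename_subst (M : Term) (σ : ℕ → Term) (ρ : ℕ → ℕ) :
    rename ρ (subst σ M) = subst (fun x => rename ρ (σ x)) M := by
  induction M generalizing σ ρ with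
  | var x => rfl
  | lam M ih => simp [rename, subst, ih, rename_up]
  | app M N ihM ihN => simp [rename, subst, ihM, ihN]

theorem subst_up (σ τ : ℕ → Term) :
    (fun x => subst (up τ) (up σ x)) = up (fun x => subst τ (σ x)) := by
  funext x
  cases x with
  | zero => rfl
  | succ x =>
    simp only [up, subst_rename, rename_subst]
    rfl

theorem subst_subst (M : Term) (σ τ : ℕ → Term) :
    subst τ (subst σ M) = subst (fun x => subst τ (σ x)) M := by
  induction M generalizing σ τ with
  | var x => rfl
  | lam M ih => simp [subst, ih, subst_up]
  | app M N ihM ihN => simp [subst, ihM, ihN]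

theorem up_var : up var = var := by
  funext x; cases x <;> rfl

theorem subst_var (M : Term) : subst var M = M := by
  induction M with
  | var x => rfl
  | lam M ih => simp [subst, up_var, ih]
  | app M N ihM ihN => simp [subst, ihM, ihN]

theorem subst_inst (M N : Term) (σ : ℕ → Term) :
    subst σ (inst M N) = inst (subst (up σ) M) (subst σ N) := by
  simp only [inst, subst_subst]
  congr 1
  funext x
  cases x with
  | zero => rfl
  | succ x =>
    simp only [up, subst_rename]
    exact (subst_var (σ x)).symm

theorem rename_inst (M N : Term) (ρ : ℕ → ℕ) :
    rename ρ (inst M N) = inst (rename (upRen ρ) M) (rename ρ N) := by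
  simp only [inst, subst_rename, rename_subst]
  congr 1
  funext x
  cases x <;> rfl

theorem subst_congr_free {M : Term} {σ τ : ℕ → Term} (h : ∀ x, FreeIn x M → σ x = τ x) :
    subst σ M = subst τ M := by
  induction M generalizing σ τ with
  | var x => exact h x rfl
  | lam M ih =>
    refine congrArg lam (ih fun x hx => ?_)
    cases x with
    | zero => rfl
    | succ x => exact congrArg (rename Nat.succ) (h x hx)
  | app M N ihM ihN =>
    exact congrArg₂ app (ihM fun x hx => h x (Or.inl hx)) (ihN fun x hx => h x (Or.inr hx))

theorem inst_eq_of_not_freeIn {M : Term} (h : ¬ FreeIn 0 M) (N N' : Term) :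
    inst M N = inst M N' := by
  refine subst_congr_free fun x hx => ?_
  cases x with
  | zero => exact absurd hx h
  | succ x => rfl

theorem FreeIn.of_rename {M : Term} {ρ : ℕ → ℕ} {k : ℕ} (h : FreeIn k (rename ρ M)) :
    ∃ x, FreeIn x M ∧ ρ x = k := by
  induction M generalizing ρ k with
  | var x => exact ⟨x, rfl, h⟩
  | lam M ih =>
    obtain ⟨x, hx, hk⟩ := ih h
    cases x with
    | zero => cases hk
    | succ x => exact ⟨x, hx, Nat.succ.inj hk⟩
  | app M N ihM ihN =>
    rcases h with h | h
    · obtain ⟨x, hx, hk⟩ := ihM h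
      exact ⟨x, Or.inl hx, hk⟩
    · obtain ⟨x, hx, hk⟩ := ihN h
      exact ⟨x, Or.inr hx, hk⟩

theorem FreeIn.of_subst {M : Term} {σ : ℕ → Term} {k : ℕ} (h : FreeIn k (subst σ M)) :
    ∃ x, FreeIn x M ∧ FreeIn k (σ x) := by
  induction M generalizing σ k with
  | var x => exact ⟨x, rfl, h⟩
  | lam M ih =>
    obtain ⟨x, hx, hk⟩ := ih h
    cases x with
    | zero => cases hk
    | succ x =>
      obtain ⟨y, hy, hyk⟩ := FreeIn.of_rename hk
      cases hyk
      exact ⟨x, hx, hy⟩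
  | app M N ihM ihN =>
    rcases h with h | h
    · obtain ⟨x, hx, hk⟩ := ihM h
      exact ⟨x, Or.inl hx, hk⟩
    · obtain ⟨x, hx, hk⟩ := ihN h
      exact ⟨x, Or.inr hx, hk⟩

theorem FreeIn.of_beta {M M' : Term} (h : Beta M M') {k : ℕ} (hk : FreeIn k M') :
    FreeIn k M := by
  induction h generalizing k with
  | beta M N =>
    obtain ⟨x, hx, hk⟩ := FreeIn.of_subst hk
    cases x with
    | zero => exact Or.inr hk
    | succ x => cases hk; exact Or.inl hx
  | lam _ ih => exact ih hk
  | appL N _ ih => exact hk.imp ih id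
  | appR M _ ih => exact hk.imp id ih

/-! ### Spines of applications -/

theorem apps_append (M : Term) (l l' : List Term) : apps M (l ++ l') = apps (apps M l) l' :=
  List.foldl_append

/-- The head of a term and the list of the arguments it is applied to. -/
def spine : Term → Term × List Term
  | var x => (var x, [])
  | lam M => (lam M, [])
  | app M N => ((spine M).1, (spine M).2 ++ [N])

theorem spine_apps (M : Term) (l : List Term) :
    spine (apps M l) = ((spine M).1, (spine M).2 ++ l) := by
  induction l generalizing M with
  | nil => simp [apps]
  | cons N l ih => exact (ih (app M N)).trans (by simp [spine])

theorem apps_spine (M : Term) : apps (spine M).1 (spine M).2 = M := by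
  induction M with
  | var x => rfl
  | lam M ih => rfl
  | app M N ihM ihN => simp only [spine, apps_append, ihM]; rfl

theorem spine_head_ne_app (M P Q : Term) : (spine M).1 ≠ app P Q := by
  induction M with
  | var x => simp [spine]
  | lam M ih => simp [spine]
  | app M N ihM ihN => exact ihM

/-- Every term is an abstraction, a variable applied to arguments, or a redex applied to
arguments. -/
theorem head_cases (M : Term) : (∃ P, M = lam P) ∨ (∃ x l, M = apps (var x) l) ∨
    ∃ P N l, M = apps (app (lam P) N) l := by
  have h := apps_spine M
  rcases hs : spine M with ⟨H, l⟩
  rw [hs] at h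
  cases H with
  | var x => exact Or.inr (Or.inl ⟨x, l, h.symm⟩)
  | lam P =>
    cases l with
    | nil => exact Or.inl ⟨P, h.symm⟩
    | cons N l => exact Or.inr (Or.inr ⟨P, N, l, h.symm⟩)
  | app P Q => exact absurd (by rw [hs]) (spine_head_ne_app M P Q)

theorem apps_redex_inj {M M' N N' : Term} {l l' : List Term}
    (h : apps (app (lam M) N) l = apps (app (lam M') N') l') : M = M' ∧ N = N' ∧ l = l' := by
  have := congrArg spine h
  simpa [spine_apps, spine] using this

theorem apps_redex_ne_lam (M N P : Term) (l : List Term) : apps (app (lam M) N) l ≠ lam P := by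
  intro h
  simpa [spine_apps, spine] using congrArg spine h

end Term

open Term

/-! ### Reduction sequences -/

theorem Steps.one {r : Term → Term → Prop} {M N : Term} (h : r M N) : Steps r 1 M N :=
  .step h (.refl N)

theorem Steps.trans {r : Term → Term → Prop} {i j : ℕ} {M N P : Term} (h : Steps r i M N)
    (h' : Steps r j N P) : Steps r (i + j) M P := by
  induction h with
  | refl M => simpa using h'
  | step hr _ ih => rw [Nat.add_right_comm]; exact .step hr (ih h')

theorem Steps.map {r s : Term → Term → Prop} (f : Term → Term)
    (hf : ∀ M N, r M N → s (f M) (f N)) {k : ℕ} {M N : Term} (h : Steps r k M N) :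
    Steps s k (f M) (f N) := by
  induction h with
  | refl M => exact .refl _
  | step hr _ ih => exact .step (hf _ _ hr) ih

theorem Beta.rename {M M' : Term} (h : Beta M M') (ρ : ℕ → ℕ) :
    Beta (rename ρ M) (rename ρ M') := by
  induction h generalizing ρ with
  | beta M N => rw [rename_inst]; exact .beta _ _
  | lam _ ih => exact .lam (ih _)
  | appL N _ ih => exact .appL _ (ih ρ)
  | appR M _ ih => exact .appR _ (ih ρ)

theorem Beta.subst {M M' : Term} (h : Beta M M') (σ : ℕ → Term) :
    Beta (subst σ M) (subst σ M') := by
  induction h generalizing σ with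
  | beta M N => rw [subst_inst]; exact .beta _ _
  | lam _ ih => exact .lam (ih _)
  | appL N _ ih => exact .appL _ (ih σ)
  | appR M _ ih => exact .appR _ (ih σ)

theorem Beta.apps {M M' : Term} (h : Beta M M') (l : List Term) :
    Beta (apps M l) (apps M' l) := by
  induction l generalizing M M' with
  | nil => exact h
  | cons N l ih => exact ih (.appL N h)

/-- If each `σ x` reduces to `τ x` in at least `f x` steps, then `M{σ}` reduces to `M{τ}` in at
least `f x` steps for every `x` that is free in `M`. -/
theorem steps_subst {M : Term} {σ τ : ℕ → Term} {f : ℕ → ℕ}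
    (h : ∀ x, ∃ i, f x ≤ i ∧ Steps Beta i (σ x) (τ x)) :
    ∃ i, (∀ x, FreeIn x M → f x ≤ i) ∧ Steps Beta i (subst σ M) (subst τ M) := by
  induction M generalizing σ τ f with
  | var x =>
    obtain ⟨i, hi, hs⟩ := h x
    refine ⟨i, fun y hy => ?_, hs⟩
    cases hy
    exact hi
  | lam M ih =>
    have key : ∀ x, ∃ i, (Nat.casesOn x 0 f : ℕ) ≤ i ∧ Steps Beta i (up σ x) (up τ x) := by
      intro x
      cases x with
      | zero => exact ⟨0, le_rfl, .refl _⟩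
      | succ x =>
        obtain ⟨i, hi, hs⟩ := h x
        exact ⟨i, hi, hs.map (rename Nat.succ) fun _ _ hb => hb.rename _⟩
    obtain ⟨i, hi, hs⟩ := ih (f := fun x => Nat.casesOn x 0 f) key
    exact ⟨i, fun x hx => hi (x + 1) hx, hs.map Term.lam fun _ _ hb => .lam hb⟩
  | app M N ihM ihN =>
    obtain ⟨i, hi, hs⟩ := ihM h
    obtain ⟨j, hj, ht⟩ := ihN h
    refine ⟨i + j, ?_, (hs.map (Term.app · _) fun _ _ hb => .appL _ hb).trans
      (ht.map (Term.app _ ·) fun _ _ hb => .appR _ hb)⟩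
    rintro x (hx | hx)
    · exact (hi x hx).trans (Nat.le_add_right i j)
    · exact (hj x hx).trans (Nat.le_add_left j i)

theorem steps_inst_right {M N N' : Term} {b : ℕ} (h0 : FreeIn 0 M) (h : Steps Beta b N N') :
    ∃ i, b ≤ i ∧ Steps Beta i (inst M N) (inst M N') := by
  obtain ⟨i, hi, hs⟩ := steps_subst (M := M) (σ := single N) (τ := single N')
    (f := fun x => Nat.casesOn x b fun _ => 0) (by
      intro x
      cases x with
      | zero => exact ⟨b, le_rfl, h⟩
      | succ x => exact ⟨0, le_rfl, .refl _⟩)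
  exact ⟨i, hi 0 h0, hs⟩

theorem Steps.inst_left {M M' : Term} {a : ℕ} (h : Steps Beta a M M') (N : Term) :
    Steps Beta a (inst M N) (inst M' N) :=
  h.map (fun M => inst M N) fun _ _ hb => hb.subst _

theorem Steps.apps {M M' : Term} {a : ℕ} (h : Steps Beta a M M') (l : List Term) :
    Steps Beta a (apps M l) (apps M' l) :=
  h.map (fun M => Term.apps M l) fun _ _ hb => hb.apps l

theorem Steps.not_freeIn {M M' : Term} {a k : ℕ} (h : Steps Beta a M M') (hk : ¬ FreeIn k M) :
    ¬ FreeIn k M' := by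
  induction h with
  | refl M => exact hk
  | step hr _ ih => exact ih fun hx => hk (FreeIn.of_beta hr hx)

/-- A step inside the arguments `l` is described by its effect on `apps H l` for every head `H`,
which makes it available again once the head redex has been contracted. -/
theorem Beta.redex_cases {M N T : Term} {l : List Term}
    (h : Beta (Term.apps (Term.app (Term.lam M) N) l) T) :
    T = Term.apps (inst M N) l ∨ (∃ M', Beta M M' ∧ T = Term.apps (Term.app (Term.lam M') N) l) ∨
      (∃ N', Beta N N' ∧ T = Term.apps (Term.app (Term.lam M) N') l) ∨
      ∃ l', (∀ H, Beta (Term.apps H l) (Term.apps H l')) ∧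
        T = Term.apps (Term.app (Term.lam M) N) l' := by
  induction l using List.reverseRecOn generalizing T with
  | nil =>
    cases h with
    | beta => exact Or.inl rfl
    | appL _ h =>
      cases h with
      | lam h => exact Or.inr (Or.inl ⟨_, h, rfl⟩)
    | appR _ h => exact Or.inr (Or.inr (Or.inl ⟨_, h, rfl⟩))
  | append_singleton l P ih =>
    have happ : ∀ H, Term.apps H (l ++ [P]) = Term.app (Term.apps H l) P :=
      fun H => apps_append H l [P]
    rw [happ] at h
    generalize hH : Term.apps (Term.app (Term.lam M) N) l = H at h
    cases h with
    | beta Q => exact absurd hH (apps_redex_ne_lam _ _ _ _)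
    | appL _ h =>
      subst hH
      rcases ih h with rfl | ⟨M', hM, rfl⟩ | ⟨N', hN, rfl⟩ | ⟨l', hl, rfl⟩
      · exact Or.inl (happ _).symm
      · exact Or.inr (Or.inl ⟨M', hM, (happ _).symm⟩)
      · exact Or.inr (Or.inr (Or.inl ⟨N', hN, (happ _).symm⟩))
      · refine Or.inr (Or.inr (Or.inr ⟨l' ++ [P], fun H => ?_, (apps_append _ l' [P]).symm⟩))
        rw [apps_append, apps_append]
        exact .appL P (hl H)
    | @appR _ _ P' h =>
      subst hH
      refine Or.inr (Or.inr (Or.inr ⟨l ++ [P'], fun H => ?_, (apps_append _ l [P']).symm⟩))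
      rw [apps_append, apps_append]
      exact .appR _ h

/-- Every reduction sequence from an applied redex starts with `a + b + c` steps inside the
body, the argument and the outer arguments, and then possibly contracts the redex: a bound for
the sequences of the second kind that ignores the contraction yields a bound for all of them. -/
theorem steps_redex_le {M N : Term} {l : List Term} {K : ℕ}
    (hK : ∀ a b c q M' N' l' T, Steps Beta a M M' → Steps Beta b N N' →
      (∀ H, Steps Beta c (apps H l) (apps H l')) → Steps Beta q (apps (inst M' N') l') T →
      a + b + c + q ≤ K)
    {j : ℕ} {T : Term} (h : Steps Beta j (apps (app (lam M) N) l) T) : j ≤ K + 1 := by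
  have key : ∀ j a b c M' N' l' T, Steps Beta a M M' → Steps Beta b N N' →
      (∀ H, Steps Beta c (apps H l) (apps H l')) →
      Steps Beta j (apps (app (lam M') N') l') T → a + b + c + j ≤ K + 1 := by
    intro j
    induction j with
    | zero =>
      intro a b c M' N' l' T ha hb hc _
      exact (hK a b c 0 M' N' l' _ ha hb hc (.refl _)).trans (Nat.le_succ K)
    | succ j ih =>
      intro a b c M' N' l' T ha hb hc h
      cases h with
      | step hr h =>
        rcases hr.redex_cases with rfl | ⟨M'', hM, rfl⟩ | ⟨N'', hN, rfl⟩ | ⟨l'', hl, rfl⟩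
        · have := hK a b c j M' N' l' _ ha hb hc h
          omega
        · have := ih _ b c _ _ _ _ (ha.trans (.one hM)) hb hc h
          omega
        · have := ih a _ c _ _ _ _ ha (hb.trans (.one hN)) hc h
          omega
        · have := ih a b _ _ _ _ _ ha hb (fun H => (hc H).trans (.one (hl H))) h
          omega
  simpa using key j 0 0 0 M N l T (.refl M) (.refl N) (fun H => .refl _) h

/-! ### The length of the perpetual strategy -/

/-- `Perp false k M`: the perpetual strategy takes `k` steps to normalise `M`, where the cost of
an erasing redex is that of normalising its argument, plus one, plus that of its contractum.
`Perp true k M` says moreover that `M` is a variable applied to arguments. -/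
inductive Perp : Bool → ℕ → Term → Prop
  | var (x : ℕ) : Perp true 0 (var x)
  | app {k k' : ℕ} {M N : Term} : Perp true k M → Perp false k' N →
      Perp true (k + k') (app M N)
  | neutral {k : ℕ} {M : Term} : Perp true k M → Perp false k M
  | lam {k : ℕ} {M : Term} : Perp false k M → Perp false k (lam M)
  | keep {k : ℕ} {M N : Term} {l : List Term} : FreeIn 0 M →
      Perp false k (apps (inst M N) l) → Perp false (k + 1) (apps (app (lam M) N) l)
  | erase {k k' : ℕ} {M N : Term} {l : List Term} : ¬ FreeIn 0 M → Perp false k' N →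
      Perp false k (apps (inst M N) l) → Perp false (k + k' + 1) (apps (app (lam M) N) l)

theorem Perp.head_eq_var {k : ℕ} {M : Term} (h : Perp true k M) : ∃ x, (spine M).1 = Term.var x := by
  generalize hb : true = b at h
  induction h with
  | var x => exact ⟨x, rfl⟩
  | app _ _ ih _ => exact ih hb
  | _ => cases hb

theorem steps_lam_le {M : Term} {k : ℕ} (hM : ∀ j T, Steps Beta j M T → j ≤ k) {j : ℕ}
    {T : Term} (h : Steps Beta j (lam M) T) : j ≤ k := by
  suffices ∃ M', Steps Beta j M M' from this.elim fun M' hM' => hM j M' hM'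
  clear hM
  generalize hP : lam M = P at h
  induction h generalizing M with
  | refl => exact ⟨M, .refl M⟩
  | step hr _ ih =>
    subst hP
    cases hr with
    | lam hr =>
      obtain ⟨M', hM'⟩ := ih rfl
      exact ⟨M', .step hr hM'⟩

theorem Beta.spine_head {M M' : Term} (h : Beta M M') {x : ℕ} (hx : (spine M).1 = Term.var x) :
    (spine M').1 = Term.var x := by
  induction h with
  | beta M N => cases hx
  | lam _ _ => cases hx
  | appL N _ ih => exact ih hx
  | appR M _ _ => exact hx

theorem steps_neutral_app_le {M N : Term} {x k k' : ℕ} (hx : (spine M).1 = var x)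
    (hM : ∀ j T, Steps Beta j M T → j ≤ k) (hN : ∀ j T, Steps Beta j N T → j ≤ k') {j : ℕ}
    {T : Term} (h : Steps Beta j (app M N) T) : j ≤ k + k' := by
  suffices ∃ a b M' N', Steps Beta a M M' ∧ Steps Beta b N N' ∧ j = a + b by
    obtain ⟨a, b, M', N', ha, hb, rfl⟩ := this
    exact add_le_add (hM _ _ ha) (hN _ _ hb)
  clear hM hN
  generalize hP : app M N = P at h
  induction h generalizing M N with
  | refl => exact ⟨0, 0, M, N, .refl M, .refl N, rfl⟩
  | step hr _ ih =>
    subst hP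
    cases hr with
    | beta => cases hx
    | appL _ hr =>
      obtain ⟨a, b, M', N', ha, hb, rfl⟩ := ih (hr.spine_head hx) rfl
      exact ⟨a + 1, b, M', N', .step hr ha, hb, by omega⟩
    | appR _ hr =>
      obtain ⟨a, b, M', N', ha, hb, rfl⟩ := ih hx rfl
      exact ⟨a, b + 1, M', N', ha, .step hr hb, by omega⟩

/-- No reduction sequence is longer than the perpetual one. For a redex that does not erase its
argument, the steps inside the argument are first performed on its copies in the contractum,
while the body still contains the variable, and then those inside the body. -/
theorem Perp.steps_le {b : Bool} {k : ℕ} {M : Term} (h : Perp b k M) :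
    ∀ j T, Steps Beta j M T → j ≤ k := by
  induction h with
  | var x =>
    intro j T h
    cases h with
    | refl => exact le_rfl
    | step hr _ => cases hr
  | app hM hN ihM ihN =>
    obtain ⟨x, hx⟩ := hM.head_eq_var
    exact fun j T h => steps_neutral_app_le hx ihM ihN h
  | neutral _ ih => exact ih
  | lam _ ih => exact fun j T h => steps_lam_le ih h
  | keep h0 _ ih =>
    intro j T h
    refine steps_redex_le (fun a b c q M' N' l' T ha hb hc hq => ?_) h
    obtain ⟨b', hb', hs⟩ := steps_inst_right h0 hb
    have := ih _ _ ((((hs.trans (ha.inst_left N')).apps _).trans (hc _)).trans hq)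
    omega
  | @erase k k' M N l h0 _ _ ihN ih =>
    intro j T h
    refine steps_redex_le (fun a b c q M' N' l' T ha hb hc hq => ?_) h
    rw [inst_eq_of_not_freeIn (ha.not_freeIn h0) N' N] at hq
    have h₁ := ih _ _ ((((ha.inst_left N).apps _).trans (hc _)).trans hq)
    have h₂ := ihN _ _ hb
    omega

theorem Head.beta_step {M M' : Term} (h : Head M M') : Beta M M' := by
  induction h with
  | beta M N l _ => exact (Beta.beta M N).apps l
  | erased M l _ _ ih => exact (Beta.appR _ ih).apps l
  | arg x l₁ l₂ _ ih =>
    simp only [apps_append]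
    exact (Beta.appR _ ih).apps l₂
  | lam _ ih => exact .lam ih

theorem BetaNormal.lam {M : Term} (h : BetaNormal M) : BetaNormal (Term.lam M) := by
  intro N hN
  cases hN with
  | lam hN => exact h _ hN

theorem BetaNormal.app {M N : Term} {x : ℕ} (hx : (spine M).1 = Term.var x) (hM : BetaNormal M)
    (hN : BetaNormal N) : BetaNormal (Term.app M N) := by
  intro P hP
  cases hP with
  | beta => cases hx
  | appL _ hP => exact hM _ hP
  | appR _ hP => exact hN _ hP

/-- The perpetual strategy does take `k` steps to normalise `M` when `Perp b k M`. For a neutral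
term the steps have to be available in front of any further arguments. -/
theorem Perp.exists_steps_head {b : Bool} {k : ℕ} {M : Term} (h : Perp b k M) :
    (∃ N, Steps Head k M N ∧ BetaNormal N) ∧
    (b = true → ∃ x l l', M = apps (Term.var x) l ∧ BetaNormal (apps (Term.var x) l') ∧
      ∀ m, Steps Head k (apps (Term.var x) (l ++ m)) (apps (Term.var x) (l' ++ m))) := by
  have neutral : ∀ {k : ℕ} {M : Term}, (∃ x l l', M = apps (Term.var x) l ∧
      BetaNormal (apps (Term.var x) l') ∧
      ∀ m, Steps Head k (apps (Term.var x) (l ++ m)) (apps (Term.var x) (l' ++ m))) →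
      ∃ N, Steps Head k M N ∧ BetaNormal N := by
    rintro k M ⟨x, l, l', rfl, hn, hs⟩
    exact ⟨_, by simpa using hs [], hn⟩
  induction h with
  | var x =>
    have h : ∃ y l l', Term.var x = apps (Term.var y) l ∧ BetaNormal (apps (Term.var y) l') ∧
        ∀ m, Steps Head 0 (apps (Term.var y) (l ++ m)) (apps (Term.var y) (l' ++ m)) := by
      refine ⟨x, [], [], rfl, fun N hN => ?_, fun m => .refl _⟩
      cases hN
    exact ⟨neutral h, fun _ => h⟩
  | @app k k' M N hM hN ihM ihN =>
    obtain ⟨x, l, l', rfl, hn, hs⟩ := ihM.2 rfl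
    obtain ⟨N', hN', hnN⟩ := ihN.1
    have h : ∃ y m m', Term.app (apps (Term.var x) l) N = apps (Term.var y) m ∧
        BetaNormal (apps (Term.var y) m') ∧
        ∀ p, Steps Head (k + k') (apps (Term.var y) (m ++ p)) (apps (Term.var y) (m' ++ p)) := by
      refine ⟨x, l ++ [N], l' ++ [N'], (apps_append _ l [N]).symm, ?_, fun p => ?_⟩
      · rw [apps_append]
        exact BetaNormal.app (x := x) (by rw [spine_apps]; rfl) hn hnN
      · have h₁ := hs (N :: p)
        have h₂ := hN'.map (fun N => apps (Term.var x) (l' ++ N :: p))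
          fun _ _ hh => Head.arg x l' p hh
        simpa using h₁.trans h₂
    exact ⟨neutral h, fun _ => h⟩
  | neutral _ ih => exact ⟨ih.1, fun h => by cases h⟩
  | lam _ ih =>
    obtain ⟨N, hN, hn⟩ := ih.1
    exact ⟨⟨_, hN.map Term.lam fun _ _ hh => Head.lam hh, hn.lam⟩, fun h => by cases h⟩
  | keep h0 _ ih =>
    obtain ⟨N, hN, hn⟩ := ih.1
    exact ⟨⟨N, .step (.beta _ _ _ (Or.inl h0)) hN, hn⟩, fun h => by cases h⟩
  | @erase k k' M N l h0 _ _ ihN ih =>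
    obtain ⟨P, hP, hn⟩ := ih.1
    obtain ⟨N', hN', hnN⟩ := ihN.1
    rw [inst_eq_of_not_freeIn h0 N N'] at hP
    have h₁ := hN'.map (fun N => apps (Term.app (Term.lam M) N) l)
      fun _ _ hh => Head.erased M l hh h0
    have h₂ := h₁.trans (.step (.beta M N' l (Or.inr hnN)) hP)
    refine ⟨⟨P, ?_, hn⟩, fun h => by cases h⟩
    rwa [show k + k' + 1 = k' + (k + 1) by omega]

theorem BetaNormal.perp {M : Term} (h : BetaNormal M) :
    Perp false 0 M ∧ ((∀ P, M ≠ Term.lam P) → Perp true 0 M) := by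
  induction M with
  | var x => exact ⟨.neutral (.var x), fun _ => .var x⟩
  | lam M ih => exact ⟨.lam (ih fun N hN => h _ (.lam hN)).1, fun hP => absurd rfl (hP M)⟩
  | app M N ihM ihN =>
    have hM := (ihM fun P hP => h _ (.appL N hP)).2 fun P hP => by
      subst hP
      exact h _ (.beta P N)
    have := Perp.app hM (ihN fun P hP => h _ (.appR M hP)).1
    exact ⟨.neutral this, fun _ => this⟩

theorem Perp.of_lam {k : ℕ} {M : Term} (h : Perp false k (Term.lam M)) : Perp false k M := by
  generalize hP : Term.lam M = P at h
  cases h with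
  | neutral h =>
    subst hP
    cases h.head_eq_var.choose_spec
  | lam h => cases hP; exact h
  | keep => exact absurd hP.symm (apps_redex_ne_lam _ _ _ _)
  | erase => exact absurd hP.symm (apps_redex_ne_lam _ _ _ _)

theorem Perp.of_erase {k : ℕ} {M N : Term} {l : List Term} (h0 : ¬ FreeIn 0 M)
    (h : Perp false k (apps (Term.app (Term.lam M) N) l)) :
    ∃ i j, k = i + j + 1 ∧ Perp false j N ∧ Perp false i (apps (inst M N) l) := by
  generalize hP : apps (Term.app (Term.lam M) N) l = P at h
  cases h with
  | neutral h =>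
    subst hP
    obtain ⟨x, hx⟩ := h.head_eq_var
    rw [spine_apps] at hx
    cases hx
  | lam h => exact absurd hP (apps_redex_ne_lam _ _ _ _)
  | keep h =>
    obtain ⟨rfl, rfl, rfl⟩ := apps_redex_inj hP
    exact absurd h h0
  | erase _ hN h =>
    obtain ⟨rfl, rfl, rfl⟩ := apps_redex_inj hP
    exact ⟨_, _, rfl, hN, h⟩

theorem Perp.true_of_head {b : Bool} {k : ℕ} {M : Term} (h : Perp b k M) {x : ℕ}
    (hx : (spine M).1 = Term.var x) : Perp true k M := by
  cases h with
  | var x => exact .var x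
  | app hM hN => exact .app hM hN
  | neutral h => exact h
  | lam h => cases hx
  | keep => rw [spine_apps] at hx; cases hx
  | erase => rw [spine_apps] at hx; cases hx

theorem Perp.of_app {k : ℕ} {M N : Term} (h : Perp true k (Term.app M N)) :
    ∃ i j, k = i + j ∧ Perp true i M ∧ Perp false j N := by
  cases h with
  | app hM hN => exact ⟨_, _, rfl, hM, hN⟩

/-- In the erasing case the step normalises the argument or discards it once normal, which is
how `Perp` counts the steps of the argument. -/
theorem Perp.of_head {M M' : Term} (h : Head M M') {k : ℕ} (hk : Perp false k M') :
    Perp false (k + 1) M := by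
  induction h generalizing k with
  | beta M N l h =>
    by_cases h0 : FreeIn 0 M
    · exact .keep h0 hk
    · exact .erase h0 (h.resolve_left h0).perp.1 hk
  | @erased M N N' l _ h0 ih =>
    obtain ⟨i, j, rfl, hN, hP⟩ := hk.of_erase h0
    rw [inst_eq_of_not_freeIn h0 N' N] at hP
    rw [Nat.add_assoc i j 1]
    exact .erase h0 (ih hN) hP
  | @arg x l₁ M M' l₂ _ ih =>
    refine .neutral ?_
    replace hk := hk.true_of_head (x := x) (by rw [spine_apps]; rfl)
    induction l₂ using List.reverseRecOn generalizing k with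
    | nil =>
      rw [apps_append] at hk ⊢
      obtain ⟨i, j, rfl, hi, hj⟩ := Perp.of_app hk
      rw [Nat.add_assoc i j 1]
      exact .app hi (ih hj)
    | append_singleton l₂ P ih' =>
      rw [← List.cons_append, ← List.append_assoc, apps_append] at hk ⊢
      obtain ⟨i, j, rfl, hi, hj⟩ := Perp.of_app hk
      rw [Nat.add_right_comm]
      exact .app (ih' hi) hj
  | lam _ ih => exact .lam (ih hk.of_lam)

/-- Every perpetual sequence to a normal form has the length recorded by `Perp`. -/
theorem Perp.of_steps_head {k : ℕ} {M N : Term} (h : Steps Head k M N) (hN : BetaNormal N) :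
    Perp false k M := by
  induction h with
  | refl M => exact hN.perp.1
  | step hr _ ih => exact .of_head hr (ih hN)
/-! ### Resources and their distribution over multisets -/

/-- The multiset of the `F`-types of which an `A`-type is the intersection. -/
def ATy.flat : ATy → Multiset FTy
  | .ofF F => {F}
  | .inter A B => A.flat + B.flat

theorem ATy.flat_ne_zero (A : ATy) : A.flat ≠ 0 := by
  cases A with
  | ofF F => exact Multiset.singleton_ne_zero F
  | inter A B =>
    intro h
    exact ATy.flat_ne_zero A (add_eq_zero.mp h).1

theorem ATy.exists_flat_eq {S : Multiset FTy} (hS : S ≠ 0) : ∃ A : ATy, A.flat = S := by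
  induction S using Multiset.induction with
  | empty => exact absurd rfl hS
  | cons F S ih =>
    by_cases h : S = 0
    · exact ⟨.ofF F, by rw [h]; rfl⟩
    · obtain ⟨A, rfl⟩ := ih h
      exact ⟨.inter (.ofF F) A, Multiset.singleton_add F A.flat⟩

/-- What a typing derivation consumes: its context, as the multiset of its pairs of a variable
and one component of the type of that variable; the number of its applications; and the sum of
the degrees of its forgotten types. All three are additive. -/
abbrev Res : Type := Multiset (ℕ × FTy) × ℕ × ℕ

namespace Res

/-- The resources `r` under one abstraction whose bound variable has the types `S`. -/
def extend (S : Multiset FTy) (r : Res) : Res :=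
  (S.map (Prod.mk 0) + r.1.map (Prod.map Nat.succ id), r.2)

theorem extend_add (S T : Multiset FTy) (r s : Res) :
    extend (S + T) (r + s) = extend S r + extend T s := by
  simp only [extend, Prod.fst_add, Prod.snd_add, Multiset.map_add, Prod.mk_add_mk]
  rw [add_add_add_comm]

theorem extend_zero : extend 0 0 = 0 := rfl

theorem exists_eq_extend (t : Res) : ∃ S r, t = extend S r := by
  obtain ⟨Γ, c⟩ := t
  induction Γ using Multiset.induction with
  | empty => exact ⟨0, (0, c), rfl⟩
  | cons p Γ ih =>
    obtain ⟨S, r, h⟩ := ih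
    have h₁ : Γ = (extend S r).1 := congrArg Prod.fst h
    have h₂ : c = r.2 := congrArg Prod.snd h
    obtain ⟨x, F⟩ := p
    cases x with
    | zero => exact ⟨F ::ₘ S, r, by simp [extend, h₁, h₂]⟩
    | succ x => exact ⟨S, ((x, F) ::ₘ r.1, r.2), by simp [extend, h₁, h₂]⟩

/-- The types of the variable `x` in a context. -/
def proj (x : ℕ) (Γ : Multiset (ℕ × FTy)) : Multiset FTy :=
  Γ.filterMap fun p => if p.1 = x then some p.2 else none

theorem proj_add (x : ℕ) (Γ Δ : Multiset (ℕ × FTy)) :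
    proj x (Γ + Δ) = proj x Γ + proj x Δ := Multiset.filterMap_add _ _ _

theorem proj_extend_zero (S : Multiset FTy) (r : Res) : proj 0 (extend S r).1 = S := by
  rw [extend, proj_add, proj, proj, Multiset.filterMap_map, Multiset.filterMap_map]
  have h₁ : (fun p : ℕ × FTy => if p.1 = 0 then some p.2 else none) ∘ Prod.mk 0 = some := by
    funext F; simp
  have h₂ : (fun p : ℕ × FTy => if p.1 = 0 then some p.2 else none) ∘ Prod.map Nat.succ id =
      fun _ => none := by
    funext F; simp
  rw [h₁, h₂, Multiset.filterMap_some]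
  induction r.1 using Multiset.induction with
  | empty => simp
  | cons p Γ ih => simpa using ih

theorem proj_extend_succ (S : Multiset FTy) (r : Res) (x : ℕ) :
    proj (x + 1) (extend S r).1 = proj x r.1 := by
  rw [extend, proj_add, proj, proj, Multiset.filterMap_map, Multiset.filterMap_map]
  have h₁ : (fun p : ℕ × FTy => if p.1 = x + 1 then some p.2 else none) ∘ Prod.mk 0 =
      fun _ => none := by
    funext F; simp
  have h₂ : (fun p : ℕ × FTy => if p.1 = x + 1 then some p.2 else none) ∘
      Prod.map Nat.succ id = fun p => if p.1 = x then some p.2 else none := by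
    funext F; simp
  rw [h₁, h₂]
  induction S using Multiset.induction with
  | empty => simp [proj]
  | cons F S ih => simpa using ih

theorem extend_inj {S T : Multiset FTy} {r s : Res} (h : extend S r = extend T s) :
    S = T ∧ r = s := by
  have hS : S = T := by rw [← proj_extend_zero S r, h, proj_extend_zero]
  subst hS
  refine ⟨rfl, Prod.ext ?_ (congrArg Prod.snd h :)⟩
  have h₁ : (extend S r).1 = (extend S s).1 := congrArg Prod.fst h
  exact Multiset.map_injective (Nat.succ_injective.prodMap Function.injective_id)
    (add_left_cancel h₁)

/-- The context of `r` only has types of the form `A⁻`. -/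
def IsNeg (r : Res) : Prop := ∀ p ∈ r.1, p.2.IsNeg

/-- The part of the degree that comes from the context and the forgotten types. -/
def degree (r : Res) : ℕ := (r.1.map fun p => p.2.degNeg).sum + r.2.2

theorem isNeg_add {r s : Res} : (r + s).IsNeg ↔ r.IsNeg ∧ s.IsNeg := by
  simp only [IsNeg, Prod.fst_add, Multiset.mem_add]
  exact ⟨fun h => ⟨fun p hp => h p (Or.inl hp), fun p hp => h p (Or.inr hp)⟩,
    fun h p hp => hp.elim (h.1 p) (h.2 p)⟩

theorem degree_add (r s : Res) : (r + s).degree = r.degree + s.degree := by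
  simp only [degree, Prod.fst_add, Prod.snd_add, Multiset.map_add, Multiset.sum_add]
  omega

theorem isNeg_mk_zero (c : ℕ × ℕ) : IsNeg (0, c) := by simp [IsNeg]

theorem isNeg_extend {S : Multiset FTy} {r : Res} :
    (extend S r).IsNeg ↔ (∀ F ∈ S, F.IsNeg) ∧ r.IsNeg := by
  simp only [IsNeg, extend, Multiset.mem_add, Multiset.mem_map]
  constructor
  · exact fun h => ⟨fun F hF => h (0, F) (Or.inl ⟨F, hF, rfl⟩),
      fun p hp => h (p.1 + 1, p.2) (Or.inr ⟨p, hp, rfl⟩)⟩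
  · rintro ⟨h₁, h₂⟩ _ (⟨F, hF, rfl⟩ | ⟨p, hp, rfl⟩)
    exacts [h₁ F hF, h₂ p hp]

theorem degree_extend (S : Multiset FTy) (r : Res) :
    (extend S r).degree = (S.map FTy.degNeg).sum + r.degree := by
  simp only [degree, extend, Multiset.map_add, Multiset.map_map, Multiset.sum_add, add_assoc]
  rfl

theorem degree_mk_zero (a e : ℕ) : degree (0, a, e) = e := by simp [degree]

end Res

open Res

theorem ATy.isNegNeg_iff (A : ATy) : A.IsNegNeg ↔ ∀ F ∈ A.flat, F.IsNeg := by
  match A with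
  | .ofF F => simp [ATy.IsNegNeg, ATy.flat]
  | .inter A B =>
    rw [ATy.IsNegNeg, ATy.isNegNeg_iff A, ATy.isNegNeg_iff B]
    simp only [ATy.flat, Multiset.mem_add]
    exact ⟨fun h p hp => hp.elim (h.1 p) (h.2 p),
      fun h => ⟨fun p hp => h p (Or.inl hp), fun p hp => h p (Or.inr hp)⟩⟩

theorem ATy.degNeg_eq (A : ATy) : A.degNeg = (A.flat.map FTy.degNeg).sum := by
  match A with
  | .ofF F => simp [ATy.degNeg, ATy.flat]
  | .inter A B =>
    rw [ATy.degNeg, ATy.degNeg_eq A, ATy.degNeg_eq B, ATy.flat, Multiset.map_add,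
      Multiset.sum_add]

/-- `Lift P s S`: each element of the multiset `S` is in relation `P` with its own share of the
resources `s`. -/
inductive Lift {X : Type} (P : Res → X → Prop) : Res → Multiset X → Prop
  | nil : Lift P 0 0
  | cons {r s : Res} {x : X} {S : Multiset X} : P r x → Lift P s S → Lift P (r + s) (x ::ₘ S)

namespace Lift

variable {X Y : Type} {P Q : Res → X → Prop}

theorem add {s t : Res} {S T : Multiset X} (hS : Lift P s S) (hT : Lift P t T) :
    Lift P (s + t) (S + T) := by
  induction hS with
  | nil => simpa using hT
  | cons h _ ih => rw [add_assoc, Multiset.cons_add]; exact .cons h ih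

theorem cons_inv {s : Res} {x : X} {S : Multiset X} (h : Lift P s (x ::ₘ S)) :
    ∃ r t, s = r + t ∧ P r x ∧ Lift P t S := by
  generalize hT : x ::ₘ S = T at h
  induction h generalizing S with
  | nil => exact absurd hT (Multiset.cons_ne_zero)
  | @cons r s y T hy hT' ih =>
    rcases Multiset.cons_eq_cons.mp hT with ⟨rfl, rfl⟩ | ⟨_, U, rfl, rfl⟩
    · exact ⟨r, s, rfl, hy, hT'⟩
    · obtain ⟨r', t, rfl, hx, ht⟩ := ih rfl
      exact ⟨r', r + t, by abel, hx, .cons hy ht⟩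

theorem zero_iff {s : Res} : Lift P s 0 ↔ s = 0 := by
  constructor
  · intro h
    generalize hT : (0 : Multiset X) = T at h
    cases h with
    | nil => rfl
    | cons => exact absurd hT.symm (Multiset.cons_ne_zero)
  · rintro rfl
    exact .nil

theorem singleton_iff {s : Res} {x : X} : Lift P s {x} ↔ P s x := by
  constructor
  · intro h
    obtain ⟨r, t, rfl, hr, ht⟩ := cons_inv (S := 0) h
    rw [zero_iff.mp ht, add_zero]
    exact hr
  · intro h
    simpa using Lift.cons h .nil

theorem add_iff {s : Res} {S T : Multiset X} :
    Lift P s (S + T) ↔ ∃ r t, s = r + t ∧ Lift P r S ∧ Lift P t T := by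
  constructor
  · intro h
    induction S using Multiset.induction generalizing s with
    | empty => exact ⟨0, s, (zero_add s).symm, .nil, by simpa using h⟩
    | cons x S ih =>
      rw [Multiset.cons_add] at h
      obtain ⟨r, t, rfl, hr, ht⟩ := cons_inv h
      obtain ⟨r', t', rfl, hr', ht'⟩ := ih ht
      exact ⟨r + r', t', (add_assoc _ _ _).symm, .cons hr hr', ht'⟩
  · rintro ⟨r, t, rfl, hr, ht⟩
    exact hr.add ht

theorem mono (h : ∀ r x, P r x → Q r x) {s : Res} {S : Multiset X} (hS : Lift P s S) :
    Lift Q s S := by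
  induction hS with
  | nil => exact .nil
  | cons hx _ ih => exact .cons (h _ _ hx) ih

theorem congr (h : ∀ r x, P r x ↔ Q r x) {s : Res} {S : Multiset X} :
    Lift P s S ↔ Lift Q s S :=
  ⟨mono fun r x => (h r x).mp, mono fun r x => (h r x).mpr⟩

theorem map_iff {P : Res → Y → Prop} (f : X → Y) {s : Res} {S : Multiset X} :
    Lift P s (S.map f) ↔ Lift (fun r x => P r (f x)) s S := by
  induction S using Multiset.induction generalizing s with
  | empty => simp [zero_iff]
  | cons x S ih =>
    rw [Multiset.map_cons]
    constructor
    · intro h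
      obtain ⟨r, t, rfl, hr, ht⟩ := cons_inv h
      exact .cons hr (ih.mp ht)
    · intro h
      obtain ⟨r, t, rfl, hr, ht⟩ := cons_inv h
      exact .cons hr (ih.mpr ht)

/-- Resources that are images under an additive map. -/
theorem image_iff {f : Res → Res} (h0 : f 0 = 0) (hadd : ∀ r s, f (r + s) = f r + f s)
    {s : Res} {S : Multiset X} :
    Lift (fun r x => ∃ r', r = f r' ∧ P r' x) s S ↔ ∃ s', s = f s' ∧ Lift P s' S := by
  constructor
  · intro h
    induction h with
    | nil => exact ⟨0, h0.symm, .nil⟩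
    | cons hx _ ih =>
      obtain ⟨r', rfl, hr⟩ := hx
      obtain ⟨s', rfl, hs⟩ := ih
      exact ⟨r' + s', (hadd _ _).symm, .cons hr hs⟩
  · rintro ⟨s', rfl, h⟩
    induction h with
    | nil => rw [h0]; exact .nil
    | cons hx _ ih => rw [hadd]; exact .cons ⟨_, rfl, hx⟩ ih

theorem eq_ctx_iff (f : X → ℕ × FTy) {s : Res} {S : Multiset X} :
    Lift (fun r x => r = ({f x}, 0)) s S ↔ s = (S.map f, 0) := by
  constructor
  · intro h
    induction h with
    | nil => rfl
    | cons hx _ ih =>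
      rw [hx, ih]
      simp
  · rintro rfl
    induction S using Multiset.induction with
    | empty => exact .nil
    | cons x S ih => simpa using Lift.cons (P := fun r x => r = ({f x}, 0)) rfl ih

end Lift

/-- `Comp Q W r x`: `x` is in relation `Q` with some resources `t`, and `r` is obtained from `t`
by replacing each entry of the context by resources that are related to it by `W`. -/
def Comp {X : Type} (Q : Res → X → Prop) (W : Res → ℕ × FTy → Prop) (r : Res) (x : X) : Prop :=
  ∃ t s, Q t x ∧ Lift W s t.1 ∧ r = s + (0, t.2)

theorem lift_comp_iff {X : Type} {Q : Res → X → Prop} {W : Res → ℕ × FTy → Prop} {r : Res}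
    {S : Multiset X} : Lift (Comp Q W) r S ↔ Comp (Lift Q) W r S := by
  constructor
  · intro h
    induction h with
    | nil => exact ⟨0, 0, .nil, .nil, rfl⟩
    | cons hx _ ih =>
      obtain ⟨t, s, ht, hs, rfl⟩ := hx
      obtain ⟨t', s', ht', hs', rfl⟩ := ih
      refine ⟨t + t', s + s', .cons ht ht', hs.add hs', ?_⟩
      rw [add_add_add_comm]
      simp
  · rintro ⟨t, s, ht, hs, rfl⟩
    induction ht generalizing s with
    | nil => rw [Lift.zero_iff.mp hs]; exact .nil
    | @cons t t' x S hx _ ih =>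
      obtain ⟨r, r', rfl, hr, hr'⟩ := Lift.add_iff.mp hs
      have := Lift.cons ⟨t, r, hx, hr, rfl⟩ (ih r' hr')
      rw [add_add_add_comm] at this
      simpa using this

/-! ### Typing modulo associativity and commutativity of intersections -/

/-- `Ty M r F`: there is a derivation of `M : F` with the resources `r` that uses no
subsumption and whose forgotten types are all of the form `A⁺`. -/
def Ty : Term → Res → FTy → Prop
  | .var x, r, F => r = ({(x, F)}, 0)
  | .lam M, r, G => ∃ A F, G = .arr A F ∧ (Ty M (extend A.flat r) F ∨
      A.IsPos ∧ ∃ r', r = r' + (0, 0, A.degPos) ∧ Ty M (extend 0 r') F)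
  | .app M N, r, F => ∃ A r₁ r₂, r = r₁ + r₂ + (0, 1, 0) ∧ Ty M r₁ (.arr A F) ∧
      Lift (Ty N) r₂ A.flat

/-- The relation `W'` is `W` pushed under one abstraction: the bound variable is sent to itself,
and the context of the image of any other variable is shifted. -/
theorem lift_extend_iff {W W' : Res → ℕ × FTy → Prop}
    (h0 : ∀ s F, W' s (0, F) ↔ s = ({(0, F)}, 0))
    (h1 : ∀ s x F, W' s (x + 1, F) ↔ ∃ s', s = extend 0 s' ∧ W s' (x, F))
    {S : Multiset FTy} {s t : Res} :
    Lift W' s (extend S t).1 ↔ ∃ s', s = extend S s' ∧ Lift W s' t.1 := by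
  have hext : ∀ s' : Res, (S.map (Prod.mk 0), 0) + extend 0 s' = extend S s' := fun s' => by
    simp [extend]
  have hS : ∀ r, Lift W' r (S.map (Prod.mk 0)) ↔ r = (S.map (Prod.mk 0), 0) := fun r => by
    rw [Lift.map_iff, ← Lift.eq_ctx_iff]
    exact Lift.congr fun r F => h0 r F
  have ht : ∀ r, Lift W' r (t.1.map (Prod.map Nat.succ id)) ↔
      ∃ s', r = extend 0 s' ∧ Lift W s' t.1 := fun r => by
    rw [Lift.map_iff, ← Lift.image_iff extend_zero fun r s => extend_add 0 0 r s]
    exact Lift.congr fun r (p : ℕ × FTy) => h1 r p.1 p.2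
  rw [extend, Lift.add_iff]
  constructor
  · rintro ⟨r, r', rfl, hr, hr'⟩
    obtain ⟨s', rfl, hs'⟩ := (ht _).mp hr'
    rw [(hS r).mp hr]
    exact ⟨s', hext s', hs'⟩
  · rintro ⟨s', rfl, hs'⟩
    exact ⟨_, _, (hext s').symm, (hS _).mpr rfl, (ht _).mpr ⟨s', rfl, hs'⟩⟩

/-- The abstraction case shared by renaming and substitution. -/
theorem ty_lam_comp {M M' : Term} {W W' : Res → ℕ × FTy → Prop}
    (h0 : ∀ s F, W' s (0, F) ↔ s = ({(0, F)}, 0))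
    (h1 : ∀ s x F, W' s (x + 1, F) ↔ ∃ s', s = extend 0 s' ∧ W s' (x, F))
    (h : ∀ r F, Ty M' r F ↔ Comp (Ty M) W' r F) (r : Res) (G : FTy) :
    Ty (lam M') r G ↔ Comp (Ty (lam M)) W r G := by
  have key : ∀ S r F, Ty M' (extend S r) F ↔
      ∃ t s, Ty M (extend S t) F ∧ Lift W s t.1 ∧ r = s + (0, t.2) := by
    intro S r F
    rw [h]
    constructor
    · rintro ⟨t', s', ht, hs, hr⟩
      obtain ⟨S', t, rfl⟩ := exists_eq_extend t'
      obtain ⟨s, rfl, hs'⟩ := (lift_extend_iff h0 h1).mp hs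
      have hr' : extend S r = extend S' (s + (0, t.2)) := by simpa [extend] using hr
      obtain ⟨rfl, rfl⟩ := extend_inj hr'
      exact ⟨t, s, ht, hs', rfl⟩
    · rintro ⟨t, s, ht, hs, rfl⟩
      exact ⟨_, _, ht, (lift_extend_iff h0 h1).mpr ⟨s, rfl, hs⟩, by simp [extend]⟩
  constructor
  · rintro ⟨A, F, rfl, hF | ⟨hA, r', rfl, hF⟩⟩
    · obtain ⟨t, s, ht, hs, rfl⟩ := (key _ _ _).mp hF
      exact ⟨t, s, ⟨A, F, rfl, Or.inl ht⟩, hs, rfl⟩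
    · obtain ⟨t, s, ht, hs, rfl⟩ := (key _ _ _).mp hF
      exact ⟨t + (0, 0, A.degPos), s, ⟨A, F, rfl, Or.inr ⟨hA, t, rfl, ht⟩⟩, by simpa using hs,
        by simp [add_assoc]⟩
  · rintro ⟨t, s, ⟨A, F, rfl, hF | ⟨hA, t, rfl, hF⟩⟩, hs, rfl⟩
    · exact ⟨A, F, rfl, Or.inl ((key _ _ _).mpr ⟨t, s, hF, hs, rfl⟩)⟩
    · refine ⟨A, F, rfl, Or.inr ⟨hA, s + (0, t.2), by simp [add_assoc],
        (key _ _ _).mpr ⟨t, s, hF, by simpa using hs, rfl⟩⟩⟩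

theorem ty_app_comp {M M' N N' : Term} {W : Res → ℕ × FTy → Prop}
    (hM : ∀ r F, Ty M' r F ↔ Comp (Ty M) W r F) (hN : ∀ r F, Ty N' r F ↔ Comp (Ty N) W r F)
    (r : Res) (F : FTy) : Ty (app M' N') r F ↔ Comp (Ty (app M N)) W r F := by
  have hN' : ∀ r S, Lift (Ty N') r S ↔ Comp (Lift (Ty N)) W r S := fun r S => by
    rw [← lift_comp_iff]
    exact Lift.congr hN
  constructor
  · rintro ⟨A, r₁, r₂, rfl, h₁, h₂⟩
    obtain ⟨t₁, s₁, ht₁, hs₁, rfl⟩ := (hM _ _).mp h₁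
    obtain ⟨t₂, s₂, ht₂, hs₂, rfl⟩ := (hN' _ _).mp h₂
    refine ⟨t₁ + t₂ + (0, 1, 0), s₁ + s₂, ⟨A, t₁, t₂, rfl, ht₁, ht₂⟩,
      by simpa using hs₁.add hs₂, ?_⟩
    rw [add_add_add_comm s₁, add_assoc]
    simp
  · rintro ⟨t, s, ⟨A, t₁, t₂, rfl, ht₁, ht₂⟩, hs, rfl⟩
    obtain ⟨s₁, s₂, rfl, hs₁, hs₂⟩ := Lift.add_iff.mp (by simpa using hs : Lift W s (t₁.1 + t₂.1))
    refine ⟨A, s₁ + (0, t₁.2), s₂ + (0, t₂.2), ?_, (hM _ _).mpr ⟨t₁, s₁, ht₁, hs₁, rfl⟩,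
      (hN' _ _).mpr ⟨t₂, s₂, ht₂, hs₂, rfl⟩⟩
    rw [add_add_add_comm s₁, add_assoc (s₁ + s₂)]
    simp

theorem ty_var_comp {M : Term} {x : ℕ} {W : Res → ℕ × FTy → Prop}
    (h : ∀ r F, Ty M r F ↔ W r (x, F)) (r : Res) (F : FTy) :
    Ty M r F ↔ Comp (Ty (var x)) W r F := by
  rw [h]
  constructor
  · exact fun hr => ⟨_, r, rfl, Lift.singleton_iff.mpr hr, (add_zero r).symm⟩
  · rintro ⟨t, s, rfl, hs, rfl⟩
    exact (add_zero s).symm ▸ Lift.singleton_iff.mp hs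

theorem ty_rename (M : Term) (ρ : ℕ → ℕ) (r : Res) (F : FTy) :
    Ty (rename ρ M) r F ↔ Comp (Ty M) (fun s p => s = ({(ρ p.1, p.2)}, 0)) r F := by
  induction M generalizing ρ r F with
  | var x => exact ty_var_comp (fun _ _ => Iff.rfl) r F
  | lam M ih =>
    refine ty_lam_comp (fun s F => Iff.rfl) (fun s x F => ?_) (ih (upRen ρ)) r F
    exact ⟨fun h => ⟨({(ρ x, F)}, 0), h, rfl⟩, by rintro ⟨_, rfl, rfl⟩; rfl⟩
  | app M N ihM ihN => exact ty_app_comp (ihM ρ) (ihN ρ) r F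

theorem ty_rename_succ (M : Term) (r : Res) (F : FTy) :
    Ty (rename Nat.succ M) r F ↔ ∃ r', r = extend 0 r' ∧ Ty M r' F := by
  rw [ty_rename]
  have key : ∀ t : Res, ((t.1.map fun p => (p.1.succ, p.2), 0) : Res) + (0, t.2) = extend 0 t :=
    fun t => by simp [extend, Prod.map_def]
  constructor
  · rintro ⟨t, s, ht, hs, rfl⟩
    rw [(Lift.eq_ctx_iff _).mp hs]
    exact ⟨t, key t, ht⟩
  · rintro ⟨t, rfl, ht⟩
    exact ⟨t, _, ht, (Lift.eq_ctx_iff _).mpr rfl, (key t).symm⟩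

/-- Substitution and anti-substitution: a derivation for `M{σ}` is the same thing as one for `M`
together with one for `σ x : F` for each entry `x : F` of its context. -/
theorem ty_subst (M : Term) (σ : ℕ → Term) (r : Res) (F : FTy) :
    Ty (subst σ M) r F ↔ Comp (Ty M) (fun s p => Ty (σ p.1) s p.2) r F := by
  induction M generalizing σ r F with
  | var x => exact ty_var_comp (fun _ _ => Iff.rfl) r F
  | lam M ih =>
    exact ty_lam_comp (fun s F => Iff.rfl) (fun s x F => ty_rename_succ (σ x) s F) (ih (up σ)) r F
  | app M N ihM ihN => exact ty_app_comp (ihM σ) (ihN σ) r F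

theorem ty_inst (M N : Term) (r : Res) (F : FTy) :
    Ty (inst M N) r F ↔
      ∃ S r₁ r₂, r = r₁ + r₂ ∧ Ty M (extend S r₁) F ∧ Lift (Ty N) r₂ S := by
  have key : ∀ (S : Multiset FTy) (t s : Res),
      Lift (fun s p => Ty (single N p.1) s p.2) s (extend S t).1 ↔
        ∃ r₂, s = r₂ + (t.1, 0) ∧ Lift (Ty N) r₂ S := by
    intro S t s
    have ht : ∀ r, Lift (fun s p => Ty (single N p.1) s p.2) r
        (t.1.map (Prod.map Nat.succ id)) ↔ r = (t.1, 0) := fun r => by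
      rw [Lift.map_iff]
      have := Lift.eq_ctx_iff (id : ℕ × FTy → ℕ × FTy) (s := r) (S := t.1)
      rw [Multiset.map_id] at this
      exact this
    rw [extend, Lift.add_iff]
    constructor
    · rintro ⟨r, r', rfl, hr, hr'⟩
      rw [(ht r').mp hr']
      exact ⟨r, rfl, (Lift.map_iff (Prod.mk 0)).mp hr⟩
    · rintro ⟨r, rfl, hr⟩
      exact ⟨r, _, rfl, (Lift.map_iff (Prod.mk 0)).mpr hr, (ht _).mpr rfl⟩
  rw [inst, ty_subst]
  constructor
  · rintro ⟨t', s, ht, hs, rfl⟩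
    obtain ⟨S, t, rfl⟩ := exists_eq_extend t'
    obtain ⟨r₂, rfl, hr⟩ := (key S t s).mp hs
    refine ⟨S, t, r₂, ?_, ht, hr⟩
    rw [add_assoc, add_comm t]
    simp [extend]
  · rintro ⟨S, t, r₂, rfl, ht, hr⟩
    refine ⟨_, _, ht, (key S t _).mpr ⟨r₂, rfl, hr⟩, ?_⟩
    rw [add_assoc, add_comm t]
    simp [extend]

/-- Derivations are relevant: the variables of the context are exactly the free variables. -/
theorem Ty.mem_ctx_iff {M : Term} {r : Res} {F : FTy} (h : Ty M r F) (k : ℕ) :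
    (∃ G, (k, G) ∈ r.1) ↔ FreeIn k M := by
  induction M generalizing r F k with
  | var x =>
    obtain rfl : r = _ := h
    simp [FreeIn, eq_comm]
  | lam M ih =>
    obtain ⟨A, F, rfl, h | ⟨_, r', rfl, h⟩⟩ := h
    · rw [FreeIn, ← ih h (k + 1)]
      simp [extend]
    · rw [FreeIn, ← ih h (k + 1)]
      simp [extend]
  | app M N ihM ihN =>
    obtain ⟨A, r₁, r₂, rfl, h₁, h₂⟩ := h
    have key : ∀ {s S}, Lift (Ty N) s S → S ≠ 0 → ((∃ G, (k, G) ∈ s.1) ↔ FreeIn k N) := by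
      intro s S h
      induction h with
      | nil => exact fun h => absurd rfl h
      | @cons r s x S hx hs ih =>
        intro _
        have hr := ihN hx k
        by_cases hS : S = 0
        · subst hS
          rw [Lift.zero_iff.mp hs, add_zero]
          exact hr
        · simp only [Prod.fst_add, Multiset.mem_add, exists_or, hr, ih hS, or_self]
    rw [FreeIn, ← ihM h₁ k, ← key h₂ A.flat_ne_zero]
    simp [exists_or]

/-! ### Subject reduction and expansion along the perpetual strategy -/

theorem Ty.zero_of_not_freeIn {M : Term} {S : Multiset FTy} {r : Res} {F : FTy}
    (h : Ty M (extend S r) F) (h0 : ¬ FreeIn 0 M) : S = 0 := by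
  refine Multiset.eq_zero_of_forall_notMem fun G hG => h0 ((h.mem_ctx_iff 0).mp ⟨G, ?_⟩)
  simp [extend, hG]

theorem Ty.ne_zero_of_freeIn {M : Term} {S : Multiset FTy} {r : Res} {F : FTy}
    (h : Ty M (extend S r) F) (h0 : FreeIn 0 M) : S ≠ 0 := by
  rintro rfl
  obtain ⟨G, hG⟩ := (h.mem_ctx_iff 0).mpr h0
  simp [extend] at hG

/-- If the derivations for `H` are those for `H'` with additional resources taken from `X`, then
the same holds when `H` and `H'` are applied to the same arguments. -/
theorem ty_apps_iff {H H' : Term} {X : Set Res}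
    (h : ∀ r F, Ty H r F ↔ ∃ x ∈ X, ∃ r', r = r' + x ∧ Ty H' r' F) (l : List Term) (r : Res)
    (F : FTy) : Ty (apps H l) r F ↔ ∃ x ∈ X, ∃ r', r = r' + x ∧ Ty (apps H' l) r' F := by
  induction l generalizing H H' with
  | nil => exact h r F
  | cons N l ih =>
    refine ih fun r F => ?_
    constructor
    · rintro ⟨A, r₁, r₂, rfl, h₁, h₂⟩
      obtain ⟨x, hx, r', rfl, h'⟩ := (h _ _).mp h₁
      exact ⟨x, hx, r' + r₂ + (0, 1, 0), by abel, A, r', r₂, rfl, h', h₂⟩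
    · rintro ⟨x, hx, r', rfl, A, r₁, r₂, rfl, h₁, h₂⟩
      exact ⟨A, r₁ + x, r₂, by abel, (h _ _).mpr ⟨x, hx, r₁, rfl, h₁⟩, h₂⟩

/-- Contracting a redex that does not erase its argument costs one application. -/
theorem ty_keep_iff {M : Term} (h0 : FreeIn 0 M) (N : Term) (l : List Term) (r : Res)
    (F : FTy) : Ty (apps (app (lam M) N) l) r F ↔
      ∃ r', r = r' + (0, 1, 0) ∧ Ty (apps (inst M N) l) r' F := by
  have := ty_apps_iff (H := app (lam M) N) (H' := inst M N) (X := {(0, 1, 0)}) (fun r F => ?_)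
    l r F
  · simpa using this
  · simp only [Set.mem_singleton_iff, exists_eq_left, ty_inst]
    constructor
    · rintro ⟨A, r₁, r₂, rfl, ⟨A', F', hF, h₁⟩, h₂⟩
      cases hF
      rcases h₁ with h₁ | ⟨_, r', _, h₁⟩
      · exact ⟨r₁ + r₂, rfl, A.flat, r₁, r₂, rfl, h₁, h₂⟩
      · exact absurd rfl (h₁.ne_zero_of_freeIn h0)
    · rintro ⟨_, rfl, S, r₁, r₂, rfl, h₁, h₂⟩
      obtain ⟨A, rfl⟩ := ATy.exists_flat_eq (h₁.ne_zero_of_freeIn h0)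
      exact ⟨A, r₁, r₂, rfl, ⟨A, F, rfl, Or.inl h₁⟩, h₂⟩

/-- Contracting an erasing redex costs one application, an optimal derivation for the erased
argument, and the degree of its type, which is forgotten. -/
theorem ty_erase_iff {M : Term} (h0 : ¬ FreeIn 0 M) (N : Term) (l : List Term) (r : Res)
    (F : FTy) : Ty (apps (app (lam M) N) l) r F ↔
      ∃ G s r', G.IsPos ∧ Ty N s G ∧ r = r' + (s + (0, 1, G.degPos)) ∧
        Ty (apps (inst M N) l) r' F := by
  have hsplit : ∀ d : ℕ, ((0, 1, d) : Res) = (0, 0, d) + (0, 1, 0) := fun d => by simp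
  have := ty_apps_iff (H := app (lam M) N) (H' := inst M N)
    (X := {x | ∃ G s, FTy.IsPos G ∧ Ty N s G ∧ x = s + (0, 1, G.degPos)}) (fun r F => ?_) l r F
  · rw [this]
    constructor
    · rintro ⟨_, ⟨G, s, hG, hs, rfl⟩, r', hr, h'⟩
      exact ⟨G, s, r', hG, hs, hr, h'⟩
    · rintro ⟨G, s, r', hG, hs, hr, h'⟩
      exact ⟨_, ⟨G, s, hG, hs, rfl⟩, r', hr, h'⟩
  · simp only [ty_inst]
    constructor
    · rintro ⟨A, r₁, r₂, rfl, ⟨A', F', hF, h₁⟩, h₂⟩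
      cases hF
      rcases h₁ with h₁ | ⟨hA, r', rfl, h₁⟩
      · exact absurd (h₁.zero_of_not_freeIn h0) A.flat_ne_zero
      · cases A with
        | inter A B => cases hA
        | ofF G =>
          refine ⟨_, ⟨G, r₂, hA, Lift.singleton_iff.mp h₂, rfl⟩, r', ?_, 0, r', 0,
            (add_zero r').symm, h₁, .nil⟩
          rw [ATy.degPos, hsplit G.degPos]
          abel
    · rintro ⟨_, ⟨G, s, hG, hs, rfl⟩, _, rfl, S, r₁, r₂, rfl, h₁, h₂⟩
      obtain rfl := h₁.zero_of_not_freeIn h0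
      obtain rfl := Lift.zero_iff.mp h₂
      refine ⟨.ofF G, r₁ + (0, 0, G.degPos), s, ?_,
        ⟨.ofF G, F, rfl, Or.inr ⟨hG, r₁, rfl, h₁⟩⟩, Lift.singleton_iff.mpr hs⟩
      rw [hsplit G.degPos]
      abel

theorem Lift.exists_le {P : Res → FTy → Prop} {s : Res} {S : Multiset FTy} (h : Lift P s S)
    (hS : S ≠ 0) : ∃ r F, P r F ∧ r.2.1 ≤ s.2.1 := by
  cases h with
  | nil => exact absurd rfl hS
  | @cons r s F S hF _ => exact ⟨r, F, hF, Nat.le_add_right _ _⟩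

/-- Typable terms are normalised by the perpetual strategy: each contraction removes an
application. -/
theorem Ty.exists_perp {M : Term} {r : Res} {F : FTy} (h : Ty M r F) : ∃ k, Perp false k M := by
  generalize hn : r.2.1 = n
  induction n using Nat.strong_induction_on generalizing M r F with
  | _ n ih =>
  have neutral : ∀ (x : ℕ) (l : List Term) (r : Res) (F : FTy), r.2.1 ≤ n →
      Ty (apps (var x) l) r F → ∃ k, Perp true k (apps (var x) l) := by
    intro x l
    induction l using List.reverseRecOn with
    | nil => exact fun _ _ _ _ => ⟨0, .var x⟩
    | append_singleton l N ihl =>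
      intro r F hr h
      rw [apps_append] at h ⊢
      obtain ⟨A, r₁, r₂, rfl, h₁, h₂⟩ := h
      obtain ⟨r', G, h', hr'⟩ := h₂.exists_le A.flat_ne_zero
      simp only [Prod.snd_add, Prod.fst_add] at hr
      obtain ⟨k, hk⟩ := ihl r₁ _ (by omega) h₁
      obtain ⟨k', hk'⟩ := ih r'.2.1 (by omega) h' rfl
      exact ⟨k + k', .app hk hk'⟩
  have redex : ∀ {M N l r F}, r.2.1 = n → Ty (apps (app (lam M) N) l) r F →
      ∃ k, Perp false k (apps (app (lam M) N) l) := by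
    intro M N l r F hr h
    by_cases h0 : FreeIn 0 M
    · obtain ⟨r', rfl, h'⟩ := (ty_keep_iff h0 N l _ _).mp h
      simp only [Prod.snd_add, Prod.fst_add] at hr
      obtain ⟨k, hk⟩ := ih r'.2.1 (by omega) h' rfl
      exact ⟨k + 1, .keep h0 hk⟩
    · obtain ⟨G, s, r', _, hs, rfl, h'⟩ := (ty_erase_iff h0 N l _ _).mp h
      simp only [Prod.snd_add, Prod.fst_add] at hr
      obtain ⟨k, hk⟩ := ih r'.2.1 (by omega) h' rfl
      obtain ⟨k', hk'⟩ := ih s.2.1 (by omega) hs rfl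
      exact ⟨_, .erase h0 hk' hk⟩
  induction M generalizing r F with
  | var x => exact ⟨0, .neutral (.var x)⟩
  | lam M ihM =>
    obtain ⟨A, F, rfl, h | ⟨_, r', rfl, h⟩⟩ := h
    · obtain ⟨k, hk⟩ := ihM h hn
      exact ⟨k, .lam hk⟩
    · obtain ⟨k, hk⟩ := ihM h (by simpa [extend] using hn)
      exact ⟨k, .lam hk⟩
  | app M N _ _ =>
    rcases head_cases (app M N) with ⟨P, hP⟩ | ⟨x, l, hP⟩ | ⟨P, Q, l, hP⟩
    · cases hP
    · rw [hP] at h ⊢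
      obtain ⟨k, hk⟩ := neutral x l r F hn.le h
      exact ⟨k, .neutral hk⟩
    · rw [hP] at h ⊢
      exact redex hn h

/-! ### Optimal derivations count the perpetual steps -/

/-- An optimal derivation of `M : F`. -/
def Opt (M : Term) (r : Res) (F : FTy) : Prop := Ty M r F ∧ F.IsPos ∧ r.IsNeg

/-- The body of an optimally typed abstraction is optimally typed; a forgotten type is lost from
the degree, whence an inequality. -/
theorem opt_lam_cases {M : Term} {r : Res} {G : FTy} (h : Opt (lam M) r G) :
    ∃ r' F, Opt M r' F ∧ r.2.1 = r'.2.1 ∧ F.degPos + r'.degree ≤ G.degPos + r.degree := by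
  obtain ⟨⟨A, F, rfl, h⟩, ⟨hA, hF⟩, hr⟩ := h
  rcases h with h | ⟨_, r, rfl, h⟩
  · refine ⟨_, F, ⟨h, hF, isNeg_extend.mpr ⟨A.isNegNeg_iff.mp hA, hr⟩⟩, rfl, ?_⟩
    rw [degree_extend, ← ATy.degNeg_eq, FTy.degPos]
    omega
  · refine ⟨_, F, ⟨h, hF, isNeg_extend.mpr ⟨by simp, (isNeg_add.mp hr).1⟩⟩, rfl, ?_⟩
    rw [degree_extend, degree_add, FTy.degPos]
    simp only [Multiset.map_zero, Multiset.sum_zero]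
    omega

/-- An abstraction can be typed optimally at no cost in degree. -/
theorem Opt.lam {M : Term} {r : Res} {F : FTy} (h : Opt M r F) :
    ∃ r' G, Opt (lam M) r' G ∧ r'.2.1 = r.2.1 ∧
      G.degPos + r'.degree = F.degPos + r.degree := by
  obtain ⟨S, r, rfl⟩ := exists_eq_extend r
  obtain ⟨h, hF, hr⟩ := h
  rw [isNeg_extend] at hr
  rw [degree_extend]
  by_cases h0 : S = 0
  · -- An atom has degree zero and is of both forms `A⁺` and `A⁻⁻`.
    subst h0
    refine ⟨r, .arr (.ofF (.atom 0)) F, ⟨⟨_, F, rfl, Or.inr ⟨trivial, r, ?_, h⟩⟩,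
      ⟨trivial, hF⟩, hr.2⟩, rfl, ?_⟩
    · exact (add_zero r).symm
    · simp [FTy.degPos, ATy.degNeg, FTy.degNeg]
  · obtain ⟨A, rfl⟩ := ATy.exists_flat_eq h0
    refine ⟨r, .arr A F, ⟨⟨A, F, rfl, Or.inl h⟩, ⟨A.isNegNeg_iff.mpr hr.1, hF⟩, hr.2⟩, rfl, ?_⟩
    rw [FTy.degPos, ATy.degNeg_eq]
    omega

/-- All optimal derivations of `M` have the same number of applications, which is at most `k`
plus the degree, with equality for at least one of them. For a neutral term the derivations of
a type `A⁻` are considered instead, and the degree of that type counts with the opposite sign;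
here it can be prescribed. -/
theorem Perp.opt {b : Bool} {k : ℕ} {M : Term} (h : Perp b k M) :
    (b = false → ∃ s, (∀ r F, Opt M r F → r.2.1 = s ∧ s ≤ k + (F.degPos + r.degree)) ∧
      ∃ r F, Opt M r F ∧ s = k + (F.degPos + r.degree)) ∧
    (b = true → ∃ s, (∀ r F, Ty M r F → r.IsNeg →
        F.IsNeg ∧ r.2.1 = s ∧ s + F.degNeg ≤ k + r.degree) ∧
      ∀ F : FTy, F.IsNeg → ∃ r, Ty M r F ∧ r.IsNeg ∧ s + F.degNeg = k + r.degree) := by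
  induction h with
  | var x =>
    refine ⟨nofun, fun _ => ⟨0, ?_, fun F hF => ⟨_, rfl, ?_, ?_⟩⟩⟩
    · rintro r F rfl hr
      exact ⟨hr (x, F) (by simp), rfl, by simp [degree]⟩
    · intro p hp
      cases Multiset.mem_singleton.mp hp
      exact hF
    · simp [degree]
  | @app k k' M N _ _ ihM ihN =>
    refine ⟨nofun, fun _ => ?_⟩
    obtain ⟨s, hs, hs'⟩ := ihM.2 rfl
    obtain ⟨t, ht, rN, G, ⟨hN, hG, hrN⟩, ht'⟩ := ihN.1 rfl
    refine ⟨s + t + 1, ?_, fun F hF => ?_⟩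
    · rintro _ F ⟨A, r₁, r₂, rfl, h₁, h₂⟩ hr
      obtain ⟨hr₁₂, -⟩ := isNeg_add.mp hr
      obtain ⟨hr₁, hr₂⟩ := isNeg_add.mp hr₁₂
      obtain ⟨⟨hA, hF⟩, hs₁, hs₂⟩ := hs _ _ h₁ hr₁
      cases A with
      | inter A B => cases hA
      | ofF G' =>
        obtain ⟨ht₁, ht₂⟩ := ht r₂ G' ⟨Lift.singleton_iff.mp h₂, hA, hr₂⟩
        rw [FTy.degNeg, ATy.degPos] at hs₂
        rw [degree_add, degree_add, degree_mk_zero]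
        refine ⟨hF, ?_, by omega⟩
        simp only [Prod.snd_add, Prod.fst_add]
        omega
    · -- The argument gets a derivation of minimal degree; its type then prescribes that of the
      -- head, where `δ⁻(G → F) = δ⁺(G) + δ⁻(F) + 1` absorbs the degree of `G`.
      obtain ⟨r, hM, hr, hs₂⟩ := hs' (.arr (.ofF G) F) ⟨hG, hF⟩
      refine ⟨r + rN + (0, 1, 0), ⟨_, r, rN, rfl, hM, Lift.singleton_iff.mpr hN⟩,
        isNeg_add.mpr ⟨isNeg_add.mpr ⟨hr, hrN⟩, isNeg_mk_zero _⟩, ?_⟩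
      rw [FTy.degNeg, ATy.degPos] at hs₂
      rw [degree_add, degree_add, degree_mk_zero]
      omega
  | neutral _ ih =>
    refine ⟨fun _ => ?_, nofun⟩
    obtain ⟨s, hs, hs'⟩ := ih.2 rfl
    refine ⟨s, ?_, ?_⟩
    · rintro r F ⟨h, _, hr⟩
      obtain ⟨_, h₁, h₂⟩ := hs r F h hr
      exact ⟨h₁, by omega⟩
    · obtain ⟨r, h, hr, h'⟩ := hs' (.atom 0) trivial
      exact ⟨r, .atom 0, ⟨h, trivial, hr⟩, by simpa [FTy.degNeg, FTy.degPos] using h'⟩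
  | lam _ ih =>
    refine ⟨fun _ => ?_, nofun⟩
    obtain ⟨s, hs, r, F, h, hr⟩ := ih.1 rfl
    refine ⟨s, ?_, ?_⟩
    · intro r G h
      obtain ⟨r', F, h', hr, hd⟩ := opt_lam_cases h
      obtain ⟨h₁, h₂⟩ := hs r' F h'
      exact ⟨hr.trans h₁, by omega⟩
    · obtain ⟨r', G, h', -, hd⟩ := h.lam
      exact ⟨r', G, h', by omega⟩
  | @keep k M N l h0 _ ih =>
    refine ⟨fun _ => ?_, nofun⟩
    obtain ⟨s, hs, r, F, ⟨h, hF, hr⟩, hd⟩ := ih.1 rfl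
    refine ⟨s + 1, ?_, r + (0, 1, 0), F, ⟨(ty_keep_iff h0 N l _ _).mpr ⟨r, rfl, h⟩, hF,
      isNeg_add.mpr ⟨hr, isNeg_mk_zero _⟩⟩, ?_⟩
    · rintro r F ⟨h, hF, hr⟩
      obtain ⟨r', rfl, h'⟩ := (ty_keep_iff h0 N l _ _).mp h
      obtain ⟨h₁, h₂⟩ := hs r' F ⟨h', hF, (isNeg_add.mp hr).1⟩
      rw [degree_add, degree_mk_zero]
      refine ⟨?_, by omega⟩
      simp only [Prod.snd_add, Prod.fst_add]
      omega
    · rw [degree_add, degree_mk_zero]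
      omega
  | @erase k k' M N l h0 _ _ ihN ih =>
    refine ⟨fun _ => ?_, nofun⟩
    obtain ⟨s, hs, r, F, ⟨h, hF, hr⟩, hd⟩ := ih.1 rfl
    obtain ⟨t, ht, rN, G, ⟨hN, hG, hrN⟩, htd⟩ := ihN.1 rfl
    refine ⟨s + t + 1, ?_, r + (rN + (0, 1, G.degPos)), F,
      ⟨(ty_erase_iff h0 N l _ _).mpr ⟨G, rN, r, hG, hN, rfl, h⟩, hF,
      isNeg_add.mpr ⟨hr, isNeg_add.mpr ⟨hrN, isNeg_mk_zero _⟩⟩⟩, ?_⟩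
    · rintro r F ⟨h, hF, hr⟩
      obtain ⟨G, rN, r', hG, hN, rfl, h'⟩ := (ty_erase_iff h0 N l _ _).mp h
      obtain ⟨hr', hr⟩ := isNeg_add.mp hr
      obtain ⟨h₁, h₂⟩ := hs r' F ⟨h', hF, hr'⟩
      obtain ⟨h₃, h₄⟩ := ht rN G ⟨hN, hG, (isNeg_add.mp hr).1⟩
      rw [degree_add, degree_add, degree_mk_zero]
      refine ⟨?_, by omega⟩
      simp only [Prod.snd_add, Prod.fst_add]
      omega
    · rw [degree_add, degree_add, degree_mk_zero]
      omega
/-! ### The equivalence of types as equality of multisets -/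

theorem AEquiv.reflexive (A : ATy) : AEquiv A A := by
  match A with
  | .ofF F => exact .refl F
  | .inter A B => exact .congr (AEquiv.reflexive A) (AEquiv.reflexive B)

theorem AEquiv.symm {A B : ATy} (h : AEquiv A B) : AEquiv B A := by
  induction h with
  | refl F => exact .refl F
  | comm A B => exact .comm B A
  | congr _ _ ih₁ ih₂ => exact .congr ih₁ ih₂
  | trans _ _ ih₁ ih₂ => exact .trans ih₂ ih₁
  | assoc A B C => exact .assoc' A B C
  | assoc' A B C => exact .assoc A B C

theorem AEquiv.flat_eq {A B : ATy} (h : AEquiv A B) : A.flat = B.flat := by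
  induction h with
  | refl F => rfl
  | comm A B => exact add_comm _ _
  | congr _ _ ih₁ ih₂ => exact congrArg₂ (· + ·) ih₁ ih₂
  | trans _ _ ih₁ ih₂ => exact ih₁.trans ih₂
  | assoc A B C => exact add_assoc _ _ _
  | assoc' A B C => exact (add_assoc _ _ _).symm

/-- Any component of a type can be moved to its front. -/
theorem ATy.equiv_of_mem_flat (A : ATy) {F : FTy} (h : F ∈ A.flat) :
    A = .ofF F ∨ ∃ B, AEquiv A (.inter (.ofF F) B) := by
  match A with
  | .ofF G => exact Or.inl (by rw [Multiset.mem_singleton.mp h])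
  | .inter A B =>
    right
    rcases Multiset.mem_add.mp h with h | h
    · rcases A.equiv_of_mem_flat h with rfl | ⟨C, hC⟩
      · exact ⟨B, .reflexive _⟩
      · exact ⟨.inter C B, .trans (.congr hC (.reflexive B)) (.assoc _ _ _)⟩
    · rcases B.equiv_of_mem_flat h with rfl | ⟨C, hC⟩
      · exact ⟨A, .comm _ _⟩
      · exact ⟨.inter C A, .trans (.trans (.comm _ _) (.congr hC (.reflexive A))) (.assoc _ _ _)⟩

theorem ATy.eq_ofF_of_flat {A : ATy} {F : FTy} (h : A.flat = {F}) : A = .ofF F := by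
  cases A with
  | ofF G => rw [Multiset.singleton_inj.mp h]
  | inter A B =>
    have h₁ := Multiset.card_pos.mpr A.flat_ne_zero
    have h₂ := Multiset.card_pos.mpr B.flat_ne_zero
    have := congrArg Multiset.card h
    simp only [ATy.flat, Multiset.card_add, Multiset.card_singleton] at this
    omega

/-- Two types are equivalent when they have the same multiset of components: a component is
brought to the front on both sides, and the remaining parts are compared. -/
theorem AEquiv.of_flat_eq {A B : ATy} (h : A.flat = B.flat) : AEquiv A B := by
  generalize hn : Multiset.card A.flat = n
  induction n generalizing A B with
  | zero => exact absurd (Multiset.card_eq_zero.mp hn) A.flat_ne_zero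
  | succ n ih =>
    obtain ⟨F, hF⟩ := Multiset.exists_mem_of_ne_zero A.flat_ne_zero
    rcases A.equiv_of_mem_flat hF with rfl | ⟨A', hA⟩
    · rw [ATy.eq_ofF_of_flat h.symm]
      exact .refl F
    · rcases B.equiv_of_mem_flat (h ▸ hF) with rfl | ⟨B', hB⟩
      · rw [ATy.eq_ofF_of_flat h]
        exact .refl F
      · have hAB : ({F} + A'.flat : Multiset FTy) = {F} + B'.flat :=
          (hA.flat_eq.symm.trans h).trans hB.flat_eq
        have hc := congrArg Multiset.card hA.flat_eq
        simp only [ATy.flat, Multiset.card_add, Multiset.card_singleton] at hc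
        exact .trans hA (.trans (.congr (.refl F) (ih (add_left_cancel hAB) (by omega))) hB.symm)

/-! ### Typing trees as derivations -/

/-- The multiset of the `F`-types of which a `U`-type is the intersection. -/
def UTy.flat : UTy → Multiset FTy
  | .omega => 0
  | .ofA A => A.flat

theorem UTy.flat_inter (U V : UTy) : (U.inter V).flat = U.flat + V.flat := by
  cases U with
  | omega => exact (zero_add V.flat).symm
  | ofA A =>
    cases V with
    | omega => exact (add_zero A.flat).symm
    | ofA B => rfl

theorem UTy.flat_eq_zero {U : UTy} (h : U.flat = 0) : U = .omega := by
  cases U with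
  | omega => rfl
  | ofA A => exact absurd h A.flat_ne_zero

theorem UTy.isNegNeg_iff (U : UTy) : U.IsNegNeg ↔ ∀ F ∈ U.flat, F.IsNeg := by
  cases U with
  | omega => simp [UTy.IsNegNeg, UTy.flat]
  | ofA A => exact A.isNegNeg_iff

theorem UTy.degNeg_eq (U : UTy) : U.degNeg = (U.flat.map FTy.degNeg).sum := by
  cases U with
  | omega => rfl
  | ofA A => exact A.degNeg_eq

theorem USub.of_aEquiv {A B : ATy} (h : AEquiv A B) : USub (.ofA A) (.ofA B) :=
  ⟨.omega, .ofA h⟩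

theorem USub.omega (A : ATy) : USub (.ofA A) .omega := ⟨.ofA A, .ofA (.reflexive A)⟩

/-- `C` is the multiset of the pairs of a variable and a component of its type in `Γ`. -/
def Ctx.Represents (Γ : Ctx) (C : Multiset (ℕ × FTy)) : Prop := ∀ x, (Γ x).flat = proj x C

theorem Ctx.Represents.add {Γ Δ : Ctx} {C D : Multiset (ℕ × FTy)} (h : Γ.Represents C)
    (h' : Δ.Represents D) : (Γ.inter Δ).Represents (C + D) := fun x => by
  rw [Ctx.inter, UTy.flat_inter, h x, h' x, proj_add]

theorem Ctx.represents_single (x : ℕ) (F : FTy) :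
    (Ctx.single x (.ofA (.ofF F))).Represents {(x, F)} := fun y => by
  by_cases h : y = x
  · subst h
    rw [proj, ← Multiset.cons_zero, Multiset.filterMap_cons_some (b := F) _ _ _ (by simp)]
    simp [Ctx.single, UTy.flat, ATy.flat]
  · simp [Ctx.single, proj, UTy.flat, h, Ne.symm h, ← Multiset.cons_zero]

theorem Ctx.Represents.isNegNeg_iff {Γ : Ctx} {C : Multiset (ℕ × FTy)} (h : Γ.Represents C) :
    (∀ x, (Γ x).IsNegNeg) ↔ ∀ p ∈ C, p.2.IsNeg := by
  simp only [UTy.isNegNeg_iff, h _, proj, Multiset.mem_filterMap]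
  constructor
  · exact fun hn p hp => hn p.1 p.2 ⟨p, hp, by simp⟩
  · rintro hn x F ⟨p, hp, hF⟩
    split at hF
    · cases hF
      exact hn p hp
    · cases hF

theorem finite_support_proj (C : Multiset (ℕ × FTy)) :
    {x | proj x C ≠ 0}.Finite := by
  refine (C.map Prod.fst).toFinset.finite_toSet.subset fun x hx => ?_
  obtain ⟨F, hF⟩ := Multiset.exists_mem_of_ne_zero hx
  obtain ⟨p, hp, hF⟩ := (Multiset.mem_filterMap _ _).mp hF
  split at hF
  · rename_i h
    simp only [Finset.mem_coe, Multiset.mem_toFinset, Multiset.mem_map]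
    exact ⟨p, hp, h⟩
  · cases hF

theorem Ctx.Represents.finsum_degNeg {Γ : Ctx} {C : Multiset (ℕ × FTy)} (h : Γ.Represents C) :
    ∑ᶠ x, (Γ x).degNeg = (C.map fun p => p.2.degNeg).sum := by
  simp only [UTy.degNeg_eq, h _]
  clear h Γ
  induction C using Multiset.induction with
  | empty => simp [proj]
  | cons p C ih =>
    have hfin : ∀ C : Multiset (ℕ × FTy),
        (Function.support fun x => ((proj x C).map FTy.degNeg).sum).Finite := fun C =>
      (finite_support_proj C).subset fun x hx h0 => hx (by simp [h0])
    have hp : ∑ᶠ x, ((proj x {p}).map FTy.degNeg).sum = p.2.degNeg := by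
      rw [finsum_eq_single _ p.1]
      · simp [← (Ctx.represents_single p.1 p.2) p.1, Ctx.single, UTy.flat, ATy.flat]
      · intro x hx
        simp [← (Ctx.represents_single p.1 p.2) x, Ctx.single, hx, UTy.flat]
    rw [Multiset.map_cons, Multiset.sum_cons, ← ih, ← hp, ← finsum_add_distrib (hfin _) (hfin _)]
    refine finsum_congr fun x => ?_
    rw [← Multiset.singleton_add, proj_add, Multiset.map_add, Multiset.sum_add]

/-- The typing tree `π` uses no subsumption, its forgotten types are all of the form `A⁺`, and
its resources are `r`. -/
def Tree.HasRes {Γ : Ctx} {M : Term} {U : UTy} (π : Tree Γ M U) (r : Res) : Prop :=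
  π.NoSubsumption ∧ (∀ B ∈ π.forg, B.IsPos) ∧ Γ.Represents r.1 ∧
    r.2 = (π.appCount, (π.forg.map ATy.degPos).sum)

theorem Tree.exists_lift {Γ : Ctx} {M : Term} {U : UTy} (π : Tree Γ M U)
    (hs : π.NoSubsumption) (hf : ∀ B ∈ π.forg, B.IsPos) :
    ∃ r, π.HasRes r ∧ Lift (Ty M) r U.flat := by
  suffices ∃ C, Γ.Represents C ∧
      Lift (Ty M) (C, π.appCount, (π.forg.map ATy.degPos).sum) U.flat by
    obtain ⟨C, hC, h⟩ := this
    exact ⟨_, ⟨hs, hf, hC, rfl⟩, h⟩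
  induction π with
  | var x F => exact ⟨_, Ctx.represents_single x F, Lift.singleton_iff.mpr rfl⟩
  | @abs Γ M F A π h ih =>
    cases hΓ : Γ 0 with
    | omega =>
      simp only [Tree.forg, hΓ, List.mem_cons, forall_eq_or_imp] at hf
      obtain ⟨C, hC, hL⟩ := ih hs.2 hf.2
      obtain ⟨S, t, ht⟩ := exists_eq_extend (C, π.appCount, (π.forg.map ATy.degPos).sum)
      have hCt : C = (extend S t).1 := congrArg Prod.fst ht
      have hS : S = 0 := by
        rw [← proj_extend_zero S t, ← hCt, ← hC 0, hΓ]
        rfl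
      subst hS
      refine ⟨t.1, fun x => ?_, Lift.singleton_iff.mpr
        ⟨A, F, rfl, Or.inr ⟨hf.1, t, ?_, ht ▸ Lift.singleton_iff.mp hL⟩⟩⟩
      · rw [hC, hCt, proj_extend_succ]
      · have h2 : t.2 = (π.appCount, (π.forg.map ATy.degPos).sum) :=
          (congrArg Prod.snd ht).symm
        obtain ⟨D, n, e⟩ := t
        cases h2
        simp [Tree.forg, hΓ, Tree.appCount, add_comm]
    | ofA B =>
      simp only [Tree.forg, hΓ] at hf
      obtain ⟨C, hC, hL⟩ := ih hs.2 hf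
      obtain ⟨S, t, ht⟩ := exists_eq_extend (C, π.appCount, (π.forg.map ATy.degPos).sum)
      have hCt : C = (extend S t).1 := congrArg Prod.fst ht
      have hAB : A.flat = B.flat := by
        rcases hs.1 with h | h
        · rw [hΓ] at h
          cases h with
          | ofA h => exact h.flat_eq
        · rw [hΓ] at h
          cases h
      have hS : S = A.flat := by
        rw [← proj_extend_zero S t, ← hCt, ← hC 0, hΓ, hAB]
        rfl
      subst hS
      have h2 : t.2 = (π.appCount, (π.forg.map ATy.degPos).sum) :=
        (congrArg Prod.snd ht).symm
      refine ⟨t.1, fun x => ?_, Lift.singleton_iff.mpr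
        ⟨A, F, rfl, Or.inl ?_⟩⟩
      · rw [hC, hCt, proj_extend_succ]
      · simp only [Tree.forg, hΓ, Tree.appCount, ← h2]
        exact ht ▸ Lift.singleton_iff.mp hL
  | @app Γ Δ M N A F π₁ π₂ ih₁ ih₂ =>
    simp only [Tree.forg, List.mem_append, or_imp, forall_and] at hf
    obtain ⟨C, hC, h₁⟩ := ih₁ hs.1 hf.1
    obtain ⟨D, hD, h₂⟩ := ih₂ hs.2 hf.2
    refine ⟨C + D, hC.add hD, Lift.singleton_iff.mpr
      ⟨A, _, _, ?_, Lift.singleton_iff.mp h₁, h₂⟩⟩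
    simp [Tree.forg, Tree.appCount]
  | @inter Γ Δ M A B π₁ π₂ ih₁ ih₂ =>
    simp only [Tree.forg, List.mem_append, or_imp, forall_and] at hf
    obtain ⟨C, hC, h₁⟩ := ih₁ hs.1 hf.1
    obtain ⟨D, hD, h₂⟩ := ih₂ hs.2 hf.2
    refine ⟨C + D, hC.add hD, ?_⟩
    have := h₁.add h₂
    simpa [Tree.forg, Tree.appCount, UTy.flat, ATy.flat] using this
  | omega M => exact ⟨0, fun x => rfl, .nil⟩

theorem Lift.exists_tree {M : Term}
    (hM : ∀ r F, Ty M r F → ∃ Γ, ∃ π : Tree Γ M (.ofA (.ofF F)), π.HasRes r) (A : ATy) {r : Res}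
    (h : Lift (Ty M) r A.flat) : ∃ Γ, ∃ π : Tree Γ M (.ofA A), π.HasRes r := by
  match A with
  | .ofF F => exact hM r F (Lift.singleton_iff.mp h)
  | .inter A B =>
    obtain ⟨s, t, rfl, hs, ht⟩ := Lift.add_iff.mp h
    obtain ⟨Γ, π₁, n₁, f₁, c₁, e₁⟩ := Lift.exists_tree hM A hs
    obtain ⟨Δ, π₂, n₂, f₂, c₂, e₂⟩ := Lift.exists_tree hM B ht
    refine ⟨_, .inter π₁ π₂, ⟨n₁, n₂⟩, ?_, c₁.add c₂, ?_⟩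
    · simp only [Tree.forg, List.mem_append, or_imp, forall_and]
      exact ⟨f₁, f₂⟩
    · simp [Tree.forg, Tree.appCount, e₁, e₂]

theorem Ty.exists_tree {M : Term} {r : Res} {F : FTy} (h : Ty M r F) :
    ∃ Γ, ∃ π : Tree Γ M (.ofA (.ofF F)), π.HasRes r := by
  induction M generalizing r F with
  | var x =>
    obtain rfl : r = _ := h
    exact ⟨_, .var x F, trivial, by simp [Tree.forg], Ctx.represents_single x F, rfl⟩
  | lam M ih =>
    obtain ⟨A, F, rfl, h | ⟨hA, t, rfl, h⟩⟩ := h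
    · obtain ⟨Γ, π, hs, hf, hc, he⟩ := ih h
      have hΓ0 : (Γ 0).flat = A.flat := by rw [hc 0, proj_extend_zero]
      cases hΓ : Γ 0 with
      | omega =>
        rw [hΓ] at hΓ0
        exact absurd hΓ0.symm A.flat_ne_zero
      | ofA B =>
        rw [hΓ] at hΓ0
        have hAB : AEquiv A B := .of_flat_eq hΓ0.symm
        have hsub : USub (.ofA A) (Γ 0) := by rw [hΓ]; exact .of_aEquiv hAB
        refine ⟨_, .abs A π hsub,
          ⟨Or.inl (by rw [hΓ]; exact .ofA hAB), hs⟩, ?_, fun x => ?_, ?_⟩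
        · simpa only [Tree.forg, hΓ] using hf
        · rw [hc, proj_extend_succ]
        · simp only [Tree.forg, hΓ, Tree.appCount]
          exact he
    · obtain ⟨Γ, π, hs, hf, hc, he⟩ := ih h
      have hΓ : Γ 0 = .omega := UTy.flat_eq_zero (by rw [hc 0, proj_extend_zero])
      have hsub : USub (.ofA A) (Γ 0) := by rw [hΓ]; exact .omega A
      refine ⟨_, .abs A π hsub, ⟨Or.inr hΓ, hs⟩, ?_, fun x => ?_, ?_⟩
      · simp only [Tree.forg, hΓ, List.mem_cons, forall_eq_or_imp]
        exact ⟨hA, hf⟩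
      · rw [hc, proj_extend_succ]
        simp
      · have he' : t.2 = (π.appCount, (π.forg.map ATy.degPos).sum) := he
        simp [Tree.forg, hΓ, Tree.appCount, he', add_comm]
  | app M N ihM ihN =>
    obtain ⟨A, r₁, r₂, rfl, h₁, h₂⟩ := h
    obtain ⟨Γ, π₁, n₁, f₁, c₁, e₁⟩ := ihM h₁
    obtain ⟨Δ, π₂, n₂, f₂, c₂, e₂⟩ := h₂.exists_tree (fun _ _ => ihN) A
    refine ⟨_, .app π₁ π₂, ⟨n₁, n₂⟩, ?_, ?_, ?_⟩
    · simp only [Tree.forg, List.mem_append, or_imp, forall_and]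
      exact ⟨f₁, f₂⟩
    · simpa using c₁.add c₂
    · simp [Tree.forg, Tree.appCount, e₁, e₂]

theorem Tree.HasRes.degree_eq {Γ : Ctx} {M : Term} {F : FTy} {π : Tree Γ M (.ofA (.ofF F))}
    {r : Res} (h : π.HasRes r) : π.degree = F.degPos + r.degree := by
  obtain ⟨-, -, hc, he⟩ := h
  rw [Tree.degree, hc.finsum_degNeg, Res.degree, he, add_assoc]
  rfl

theorem Tree.Optimal.exists_opt {Γ : Ctx} {M : Term} {U : UTy} {π : Tree Γ M U}
    (h : π.Optimal) :
    ∃ r F, Opt M r F ∧ r.2.1 = π.appCount ∧ π.degree = F.degPos + r.degree := by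
  obtain ⟨hs, hU, hΓ, hf⟩ := h
  match U, hU with
  | .ofA (.ofF F), hU =>
    obtain ⟨r, hr, h⟩ := π.exists_lift hs hf
    exact ⟨r, F, ⟨Lift.singleton_iff.mp h, hU, hr.2.2.1.isNegNeg_iff.mp hΓ⟩, by rw [hr.2.2.2],
      hr.degree_eq⟩

theorem Opt.exists_optimal {M : Term} {r : Res} {F : FTy} (h : Opt M r F) :
    ∃ Γ, ∃ π : Tree Γ M (.ofA (.ofF F)), π.Optimal ∧ π.degree = F.degPos + r.degree := by
  obtain ⟨h, hF, hr⟩ := h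
  obtain ⟨Γ, π, hπ⟩ := h.exists_tree
  exact ⟨Γ, π, ⟨hπ.1, hF, hπ.2.2.1.isNegNeg_iff.mpr hr, hπ.2.1⟩, hπ.degree_eq⟩

/-- A principal typing tree has as many applications as the perpetual strategy has steps plus
its degree. -/
theorem Tree.Principal.exists_perp {Γ : Ctx} {M : Term} {U : UTy} {π : Tree Γ M U}
    (h : π.Principal) : ∃ k, Perp false k M ∧ π.appCount = k + π.degree ∧
      ∀ j, Perp false j M → j = k := by
  obtain ⟨r, F, hopt, hn, hd⟩ := h.1.exists_opt
  have key : ∀ k, Perp false k M → π.appCount = k + π.degree := by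
    intro k hk
    obtain ⟨s, hs, r', F', hopt', hs'⟩ := hk.opt.1 rfl
    obtain ⟨Γ', π', hπ', hd'⟩ := hopt'.exists_optimal
    have hmin := h.2 _ _ π' hπ'
    obtain ⟨h₁, h₂⟩ := hs r F hopt
    omega
  obtain ⟨k, hk⟩ := hopt.1.exists_perp
  refine ⟨k, hk, key k hk, fun j hj => ?_⟩
  have h₁ := key k hk
  have h₂ := key j hj
  omega

end PureLambda

theorem mainTheorem3 (M : PureLambda.Term) (Γ : PureLambda.Ctx) (A : PureLambda.ATy)
    (π : PureLambda.Tree Γ M (PureLambda.UTy.ofA A)) (hπ : π.Principal)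
    (n d : ℕ) (hn : π.appCount = n) (hd : π.degree = d) :
    d ≤ n ∧
    IsGreatest {k : ℕ | ∃ N, PureLambda.Steps PureLambda.Beta k M N} (n - d) ∧
    (∃ N, PureLambda.Steps PureLambda.Head (n - d) M N ∧ PureLambda.BetaNormal N) ∧
    (∀ (k : ℕ) (N : PureLambda.Term),
      PureLambda.Steps PureLambda.Head k M N → PureLambda.BetaNormal N → k = n - d) := by
  obtain ⟨k, hk, hkd, huniq⟩ := hπ.exists_perp
  rw [hn, hd] at hkd
  obtain rfl : k = n - d := by omega
  obtain ⟨N, hN, hnorm⟩ := hk.exists_steps_head.1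
  refine ⟨by omega, ⟨⟨N, hN.map id fun _ _ h => h.beta_step⟩, ?_⟩, ⟨N, hN, hnorm⟩, ?_⟩
  · rintro j ⟨T, hT⟩
    exact hk.steps_le j T hT
  · intro j T hT hnT
    exact huniq j (.of_steps_head hT hnT)
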